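/- **Setting.** Let $\mathrm{H}=\{f\in L^2(\mathbb R): f=0 \text{ a.e. outside } [0,1]\}$ (complex valued) and $\hat f(\omega)=\int_{\mathbb R} f(x)e^{-2\pi i\omega x}\,dx$. Let $\{\omega_n\}_{n\in\mathbb Z}\subset\mathbb R$ be a nondecreasing sequence that gives rise to a Fourier frame for $\mathrm H$ with frame bounds $A,B$, i.e. $A>0$ and $A\|f\|^2\le\sum_{n\in\mathbb Z}|\hat f(\omega_n)|^2\le B\|f\|^2$ (with convergent sum) for all $f\in\mathrm H$. For $N\in\mathbb N_0$ put $\Omega=\Omega_N=\{\omega_n:|n|\le N\}$ and let $\mathcal S_N:\mathrm H\to\mathrm H$ be the partial frame operator $\mathcal S_Nf=\sum_{|n|\le N}\hat f(\omega_n)e^{2\pi i\omega_n\cdot}\mathbb I_{[0,1]}$. For a finite-dimensional subspace $\mathrm T\subseteq\mathrm H$, a bounded linear operator $\mathcal S$ on $\mathrm H$ is *admissible* for $(\Omega,\mathrm T)$ if $\mathcal Sf$ depends only on $\{\hat f(\omega):\omega\in\Omega\}$; $\mathcal S$ is self-adjoint with $|\langle\mathcal Sf,g\rangle|\le\sqrt{\langle\mathcal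 Sf,f\rangle\langle\mathcal Sg,g\rangle}$ for all $f,g\in\mathrm H$; and $\langle\mathcal Sf,f\rangle\ge c\|f\|^2$ on $\mathrm T$ for some $c>0$. Let $C_1$ be the largest constant with $\langle\mathcal Sf,f\rangle\ge C_1\|f\|^2$ for all $f\in\mathrm T$, and $C_2$ the smallest with $\langle\mathcal Sf,f\rangle\le C_2\|f\|^2$ for all $f\in\mathrm H$. The reconstruction constant is $C(\Omega,\mathrm T)=\sqrt{C_2/C_1}$; below it is taken for $\mathcal S=\mathcal S_N$. **Wavelet spaces.** Let $(V_j)_{j\in\mathbb Z}$ be a multiresolution analysis of $L^2(\mathbb R)$ generated by $\phi\in L^2(\mathbb R)$: the $V_j$ are closed and nested, $\overline{\bigcup_jV_j}=L^2(\mathbb R)$, $\bigcap_jV_j=\{0\}$, $f\in V_j\Leftrightarrow f(2\cdot)\in V_{j+1}$, and $\{\phi(\cdot-k)\}_{k\in\mathbb Z}$ is a Riesz basis of $V_0$. Write $f_{j,k}(x)=2^{j/2}f(2^jx-k)$. Let $\psi$ be an associated wavelet of compact support: $\{\psi_{j,k}\}_{j,k\in\mathbb Z}$ is a Riesz basis of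 $L^2(\mathbb R)$ and $V_1=V_0\oplus\overline{\operatorname{span}}\{\psi(\cdot-k):k\in\mathbb Z\}$ (direct, not necessarily orthogonal, sum). Let $\operatorname{supp}\phi\subseteq[-p+1,p]$, $p\in\mathbb N$, and suppose that $|\hat\phi(\omega)|\le c(1+|\omega|)^{-\alpha}$ for all $\omega\in\mathbb R$, with some $c$ and some $\alpha>\tfrac12$. For each type define subspaces of $\mathrm H$ as follows, all functions being restricted to $[0,1]$. * **per**: with $f^{\mathrm{per}}(x)=\sum_{m\in\mathbb Z}f(x+m)$, let $V_j^{\mathrm{per}}=\operatorname{span}\{\phi_{j,k}^{\mathrm{per}}:0\le k<2^j\}$ and $W_j^{\mathrm{per}}=\operatorname{span}\{\psi_{j,k}^{\mathrm{per}}:0\le k<2^j\}$. * **fold**: with $f^{\mathrm{fold}}(x)=\sum_{m\in\mathbb Z}f(x-2m)+\sum_{m\in\mathbb Z}f(2m-x)$, let $V_j^{\mathrm{fold}}=\operatorname{span}\{\phi_{j,k}^{\mathrm{fold}}:0\le k\le2^j-\iota\}$ and $W_j^{\mathrm{fold}}=\operatorname{span}\{\psi_{j,k}^{\mathrm{fold}}:0\le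 k<2^j\}$. Here $\iota\in\{0,1\}$; one takes $\iota=0$ for wavelets symmetric about $1/2$ and $\iota=1$ for antisymmetric ones, and the assertion holds for either value. * **int** (boundary wavelets of Cohen, Daubechies and Vial): let $\phi^{\mathrm{left}}_k$, $0\le k<p$, be obtained from the functions $\mathbb I_{[0,\infty)}(x)\sum_{n=k}^{2p-2}\binom nk\phi(x+n-p+1)$ by Gram–Schmidt orthonormalization in the order $k=p-1,\dots,0$ (a function that depends linearly on its predecessors gives $0$), and let $\phi^{\mathrm{right}}_k(x)$ be the value at $-x$ of the function obtained in the same way from $\phi(1-\cdot)$. For $2p\le2^j$ put $\phi^{\mathrm{int}}_{j,k}=2^{j/2}\phi^{\mathrm{left}}_k(2^j\cdot)$ for $0\le k<p$, $\phi^{\mathrm{int}}_{j,k}=\phi_{j,k}$ for $p\le k<2^j-p$, and $\phi^{\mathrm{int}}_{j,k}=2^{j/2}\phi^{\mathrm{right}}_{2^j-k-1}(2^j(\cdot-1))$ for $2^j-p\le k<2^j$. Let $V_j^{\mathrm{int}}=\operatorname{span}\{\phi^{\mathrm{int}}_{j,k}:0\le k<2^j\}$ and let $W_j^{\mathrm{int}}$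 be the orthogonal complement of $V_j^{\mathrm{int}}$ in $V_{j+1}^{\mathrm{int}}$, i.e. $V_{j+1}^{\mathrm{int}}\cap(V_j^{\mathrm{int}})^\perp$. For $0\le J\le R$ (and $2p\le2^J$ if the type is int) the reconstruction space is $$\mathrm T=\mathrm T_{J,R}=V_J^{\mathrm{type}}+W_J^{\mathrm{type}}+W_{J+1}^{\mathrm{type}}+\dots+W_{R-1}^{\mathrm{type}}.$$ **Theorem.** Let $\mathrm{type}\in\{\mathrm{per},\mathrm{fold},\mathrm{int}\}$. For every $0<\epsilon<A$ there is a constant $c_0=c_0(\epsilon)>0$, independent of $N$, $R$ and $J$, such that for all such $J\le R$ and all $N\ge c_0(\epsilon)2^R$ the operator $\mathcal S_N$ is admissible for $(\Omega_N,\mathrm T_{J,R})$ and $$C(\Omega_N,\mathrm T_{J,R})\le\sqrt{\frac{B}{A-\epsilon}}.$$ -/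

import Mathlib

open MeasureTheory Set
open scoped FourierTransform InnerProductSpace

noncomputable section

namespace NUGS

/-! ### The Hilbert spaces -/

/-- `L²(ℝ)`, complex valued. -/
abbrev L2 : Type := Lp ℂ 2 (volume : Measure ℝ)

/-- The class in `L²(ℝ)` of a square integrable function (`0` if `f` is not square integrable). -/
def toL2 (f : ℝ → ℂ) : L2 :=
  open Classical in if h : MemLp f 2 volume then h.toLp f else 0

theorem toL2_coeFn {f : ℝ → ℂ} (h : MemLp f 2 volume) :
    (toL2 f : ℝ → ℂ) =ᵐ[volume] f := by
  rw [toL2, dif_pos h]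
  exact h.coeFn_toLp

/-- The space `H` of all `f ∈ L²(ℝ)` that vanish almost everywhere outside `[0,1]`. -/
def H : Submodule ℂ L2 where
  carrier := {f | ∀ᵐ x : ℝ, x ∉ Icc (0 : ℝ) 1 → (f : ℝ → ℂ) x = 0}
  zero_mem' := by
    filter_upwards [Lp.coeFn_zero ℂ 2 (volume : Measure ℝ)] with x hx _
    exact hx
  add_mem' := by
    intro f g hf hg
    filter_upwards [hf, hg, Lp.coeFn_add f g] with x h1 h2 h3 hx
    rw [h3, Pi.add_apply, h1 hx, h2 hx, add_zero]
  smul_mem' := by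
    intro c f hf
    filter_upwards [hf, Lp.coeFn_smul c f] with x h1 h2 hx
    rw [h2, Pi.smul_apply, h1 hx, smul_zero]

theorem toL2_indicator_mem (g : ℝ → ℂ) : toL2 ((Icc (0 : ℝ) 1).indicator g) ∈ H := by
  by_cases h : MemLp ((Icc (0 : ℝ) 1).indicator g) 2 volume
  · change ∀ᵐ x : ℝ, _
    filter_upwards [toL2_coeFn h] with x hx hx'
    rw [hx, indicator_of_notMem hx']
  · rw [toL2, dif_neg h]
    exact H.zero_mem

/-- The element `g · 𝟙_[0,1]` of `H`. -/
def restr (g : ℝ → ℂ) : H := ⟨toL2 ((Icc (0 : ℝ) 1).indicator g), toL2_indicator_mem g⟩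

/-! ### Fourier samples and the partial frame operator -/

/-- The function `x ↦ exp (2 π i w x)`. -/
def expFun (w : ℝ) (x : ℝ) : ℂ := Complex.exp (2 * Real.pi * Complex.I * w * x)

theorem memLp_expFun (w : ℝ) : MemLp ((Icc (0 : ℝ) 1).indicator (expFun w)) 2 volume := by
  rw [memLp_indicator_iff_restrict measurableSet_Icc]
  have hc : Continuous (expFun w) := by unfold expFun; fun_prop
  refine MemLp.of_bound hc.aestronglyMeasurable 1 (Filter.Eventually.of_forall fun x => ?_)
  have : expFun w x = Complex.exp ((2 * Real.pi * w * x : ℝ) * Complex.I) := by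
    unfold expFun; push_cast; ring_nf
  rw [this, Complex.norm_exp_ofReal_mul_I]

/-- On `H`, the functional `f ↦ 𝓕 f w` is the inner product with `exp (2 π i w ·) 𝟙_[0,1]`. -/
theorem inner_restr_expFun (w : ℝ) (f : H) :
    ⟪restr (expFun w), f⟫_ℂ = 𝓕 (((f : L2) : ℝ → ℂ)) w := by
  rw [Submodule.coe_inner, L2.inner_def, Real.fourier_eq']
  refine integral_congr_ae ?_
  filter_upwards [f.2, toL2_coeFn (memLp_expFun w)] with x hx he
  change ⟪(toL2 ((Icc (0 : ℝ) 1).indicator (expFun w)) : ℝ → ℂ) x, _⟫_ℂ = _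
  rw [he]
  by_cases hx' : x ∈ Icc (0 : ℝ) 1
  · rw [indicator_of_mem hx', RCLike.inner_apply, smul_eq_mul, mul_comm, expFun,
      ← Complex.exp_conj]
    congr 2
    simp only [map_mul, Complex.conj_I, Complex.conj_ofReal, Complex.conj_ofNat]
    simp
    ring
  · rw [hx hx']
    simp

/-- The sampling functional `f ↦ f̂(w)` on `H`, with `f̂(w) = ∫ f(x) exp (-2 π i w x) dx`. -/
def sample (w : ℝ) : H →L[ℂ] ℂ :=
  (innerSL ℂ (restr (expFun w))).copy (fun f => 𝓕 (((f : L2) : ℝ → ℂ)) w)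
    (funext fun f => (inner_restr_expFun w f).symm)

theorem sample_apply (w : ℝ) (f : H) : sample w f = 𝓕 (((f : L2) : ℝ → ℂ)) w := rfl

/-- `ω` gives rise to a Fourier frame for `H` with frame bounds `A` and `B`. -/
def IsFourierFrame (ω : ℤ → ℝ) (A B : ℝ) : Prop :=
  0 < A ∧ ∀ f : H, Summable (fun n => ‖sample (ω n) f‖ ^ 2) ∧
    A * ‖f‖ ^ 2 ≤ ∑' n, ‖sample (ω n) f‖ ^ 2 ∧
    ∑' n, ‖sample (ω n) f‖ ^ 2 ≤ B * ‖f‖ ^ 2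

/-- The sampling scheme `{ω n : |n| ≤ N}`. -/
def scheme (ω : ℤ → ℝ) (N : ℕ) : Set ℝ := ω '' Icc (-(N : ℤ)) N

/-- The partial frame operator
`f ↦ ∑_{|n| ≤ N} f̂(ω n) exp (2 π i (ω n) ·) 𝟙_[0,1]` on `H`. -/
def partialFrameOp (ω : ℤ → ℝ) (N : ℕ) : H →L[ℂ] H :=
  ∑ n ∈ Finset.Icc (-(N : ℤ)) N, (sample (ω n)).smulRight (restr (expFun (ω n)))

/-! ### Admissible sampling operators and the reconstruction constant -/

/-- `S` is an admissible sampling operator for the sampling scheme `Ω` and the finite-dimensional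
reconstruction space `T`. -/
structure IsAdmissible (Ω : Set ℝ) (T : Submodule ℂ H) (S : H →L[ℂ] H) : Prop where
  finite_scheme : Ω.Finite
  finiteDimensional : FiniteDimensional ℂ T
  depends_on_samples : ∀ f g : H, (∀ w ∈ Ω, sample w f = sample w g) → S f = S g
  selfAdjoint : ∀ f g : H, ⟪S f, g⟫_ℂ = ⟪f, S g⟫_ℂ
  cauchySchwarz : ∀ f g : H,
    ‖⟪S f, g⟫_ℂ‖ ≤ Real.sqrt ((⟪S f, f⟫_ℂ).re * (⟪S g, g⟫_ℂ).re)
  bounded_below : ∃ c : ℝ, 0 < c ∧ ∀ f ∈ T, c * ‖f‖ ^ 2 ≤ (⟪S f, f⟫_ℂ).re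

/-- The largest `c` with `c ‖f‖² ≤ ⟨S f, f⟩` for all `f ∈ T`. -/
def constC1 (S : H →L[ℂ] H) (T : Submodule ℂ H) : ℝ :=
  sSup {c : ℝ | ∀ f ∈ T, c * ‖f‖ ^ 2 ≤ (⟪S f, f⟫_ℂ).re}

/-- The smallest `c` with `⟨S f, f⟩ ≤ c ‖f‖²` for all `f ∈ H`. -/
def constC2 (S : H →L[ℂ] H) : ℝ :=
  sInf {c : ℝ | ∀ f : H, (⟪S f, f⟫_ℂ).re ≤ c * ‖f‖ ^ 2}

/-- The reconstruction constant `√(C₂ / C₁)`. -/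
def reconstructionConstant (S : H →L[ℂ] H) (T : Submodule ℂ H) : ℝ :=
  Real.sqrt (constC2 S / constC1 S T)

/-! ### Multiresolution analyses and wavelets on the line -/

/-- `v` is a Riesz basis of the subspace `M` of `L²(ℝ)`. -/
def IsRieszBasis {I : Type} (v : I → L2) (M : Submodule ℂ L2) : Prop :=
  (Submodule.span ℂ (range v)).topologicalClosure = M ∧
    ∃ d₁ d₂ : ℝ, 0 < d₁ ∧ 0 < d₂ ∧ ∀ (s : Finset I) (a : I → ℂ),
      d₁ * ∑ i ∈ s, ‖a i‖ ^ 2 ≤ ‖∑ i ∈ s, a i • v i‖ ^ 2 ∧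
      ‖∑ i ∈ s, a i • v i‖ ^ 2 ≤ d₂ * ∑ i ∈ s, ‖a i‖ ^ 2

/-- The dilated translate `2^{j/2} f(2^j x - k)`. -/
def dil (f : ℝ → ℂ) (j k : ℤ) (x : ℝ) : ℂ :=
  (((2 : ℝ) ^ ((j : ℝ) / 2) : ℝ) : ℂ) * f ((2 : ℝ) ^ j * x - k)

/-- `V` is a multiresolution analysis of `L²(ℝ)` generated by the scaling function `φ`. -/
structure IsMRA (φ : ℝ → ℂ) (V : ℤ → Submodule ℂ L2) : Prop where
  memLp : MemLp φ 2 volume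
  closed : ∀ j, IsClosed (V j : Set L2)
  nested : ∀ j, V j ≤ V (j + 1)
  dense_union : Dense (⋃ j, (V j : Set L2))
  inter_trivial : ⨅ j, V j = ⊥
  dilation : ∀ (j : ℤ) (f g : L2), ((g : ℝ → ℂ) =ᵐ[volume] fun x => (f : ℝ → ℂ) (2 * x)) →
    (f ∈ V j ↔ g ∈ V (j + 1))
  riesz : IsRieszBasis (fun k : ℤ => toL2 (dil φ 0 k)) (V 0)

/-- `ψ` generates a wavelet basis `ψ_{j,k}` of `L²(ℝ)` associated with the multiresolution
analysis `V`: the translates of `ψ` span a complement of `V 0` in `V 1`. -/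
structure IsWavelet (ψ : ℝ → ℂ) (V : ℤ → Submodule ℂ L2) : Prop where
  memLp : MemLp ψ 2 volume
  riesz : IsRieszBasis (fun i : ℤ × ℤ => toL2 (dil ψ i.1 i.2)) ⊤
  sup_eq : V 0 ⊔
    (Submodule.span ℂ (range fun k : ℤ => toL2 (dil ψ 0 k))).topologicalClosure = V 1
  inf_eq : V 0 ⊓
    (Submodule.span ℂ (range fun k : ℤ => toL2 (dil ψ 0 k))).topologicalClosure = ⊥

/-! ### Periodic, folded and boundary wavelets on the interval -/

/-- The periodizing operation. -/
def periodize (f : ℝ → ℂ) (x : ℝ) : ℂ := ∑' m : ℤ, f (x + m)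

/-- The folding operation. -/
def fold (f : ℝ → ℂ) (x : ℝ) : ℂ := ∑' m : ℤ, f (x - 2 * m) + ∑' m : ℤ, f (2 * m - x)

/-- For `k = 0, …, p - 1`, the combinations `∑_{n=k}^{2p-2} (n choose k) φ(x + n - p + 1)` on
the half-line `[0, ∞)`, from which the left boundary scaling functions of
Cohen, Daubechies and Vial are obtained. -/
def preLeft (φ : ℝ → ℂ) (p k : ℕ) : ℝ → ℂ :=
  (Ici (0 : ℝ)).indicator fun x =>
    ∑ n ∈ Finset.Icc k (2 * p - 2), (n.choose k : ℂ) * φ (x + n - p + 1)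

/-- The left boundary scaling functions `φ^left_k`, `k = 0, …, p - 1`: the functions `preLeft`
orthonormalized by the Gram-Schmidt process, starting with `k = p - 1` and ending with `k = 0`. -/
def leftEdge (φ : ℝ → ℂ) (p : ℕ) (k : Fin p) : ℝ → ℂ :=
  (InnerProductSpace.gramSchmidtNormed ℂ
    (fun i : Fin p => toL2 (preLeft φ p (Fin.rev i))) (Fin.rev k) : L2)

/-- The right boundary scaling functions, by reflection: `φ(1 - ·)` is again supported in
`[-p + 1, p]`, and `φ^right_k(x)` is its left boundary function at `-x`. -/
def rightEdge (φ : ℝ → ℂ) (p : ℕ) (k : Fin p) (x : ℝ) : ℂ :=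
  leftEdge (fun y => φ (1 - y)) p k (-x)

/-- The boundary scaling functions `φ^int_{j,k}`, `k = 0, …, 2^j - 1` (for `2 p ≤ 2^j`). -/
def intScaling (φ : ℝ → ℂ) (p j k : ℕ) (x : ℝ) : ℂ :=
  if h : k < p then
    (((2 : ℝ) ^ ((j : ℝ) / 2) : ℝ) : ℂ) * leftEdge φ p ⟨k, h⟩ ((2 : ℝ) ^ j * x)
  else if h' : 2 ^ j - k - 1 < p then
    (((2 : ℝ) ^ ((j : ℝ) / 2) : ℝ) : ℂ) *
      rightEdge φ p ⟨2 ^ j - k - 1, h'⟩ ((2 : ℝ) ^ j * (x - 1))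
  else dil φ j k x

/-- The three constructions. In the folded case the scaling functions at level `j` are indexed by
`k = 0, …, 2^j - ι`, with `ι = 0` for wavelets symmetric about `1/2` and `ι = 1` for antisymmetric
ones. -/
inductive WaveletType : Type
  | per : WaveletType
  | fold (ι : Fin 2) : WaveletType
  | int : WaveletType

/-- The scaling space `V_j` on the interval, a subspace of `H`. -/
def scalingSpace (φ : ℝ → ℂ) (p : ℕ) : WaveletType → ℕ → Submodule ℂ H
  | .per, j => Submodule.span ℂ {f | ∃ k : ℕ, k < 2 ^ j ∧ f = restr (periodize (dil φ j k))}
  | .fold ι, j => Submodule.span ℂ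
      {f | ∃ k : ℕ, k + (ι : ℕ) ≤ 2 ^ j ∧ f = restr (NUGS.fold (dil φ j k))}
  | .int, j => Submodule.span ℂ {f | ∃ k : ℕ, k < 2 ^ j ∧ f = restr (intScaling φ p j k)}

/-- The wavelet space `W_j` on the interval, a subspace of `H`. For boundary wavelets it is the
orthogonal complement of `V_j` in `V_{j+1}`. -/
def waveletSpace (φ ψ : ℝ → ℂ) (p : ℕ) : WaveletType → ℕ → Submodule ℂ H
  | .per, j => Submodule.span ℂ {f | ∃ k : ℕ, k < 2 ^ j ∧ f = restr (periodize (dil ψ j k))}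
  | .fold _, j => Submodule.span ℂ
      {f | ∃ k : ℕ, k < 2 ^ j ∧ f = restr (NUGS.fold (dil ψ j k))}
  | .int, j => scalingSpace φ p .int (j + 1) ⊓ (scalingSpace φ p .int j)ᗮ

/-- The reconstruction space `T = V_J + W_J + W_{J+1} + ⋯ + W_{R-1}`. -/
def reconstructionSpace (φ ψ : ℝ → ℂ) (p : ℕ) (type : WaveletType) (J R : ℕ) :
    Submodule ℂ H :=
  scalingSpace φ p type J ⊔ ⨆ j ∈ Finset.Ico J R, waveletSpace φ ψ p type j

end NUGS

end

open MeasureTheory Set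
open scoped FourierTransform InnerProductSpace

noncomputable section

namespace NUGS

/-! ### Approximation of a finite-dimensional space by test functions -/

/-! Everything reduces to a tail bound: for `f` in the reconstruction space, the samples with `|n| >
N` carry at most `ε‖f‖²`. Subtracting this from the lower frame bound gives `C₁ ≥ A - ε` (when the
space is nonzero), while `C₂ ≤ B` is the upper frame bound.

The space is local: on each dyadic cell of length `2⁻ᴿ`, a function in it, rescaled to `(0,1)`, lies
in the finite-dimensional space `cellSpace φ`, which depends neither on the cell nor on `J` and `R`
(`reconstructionSpace_le_localH`). Indeed integer translation, reflection and cutting at `0` and `1`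
respect the dyadic grid, and the nesting of the `V_j` refines coarse functions to fine ones.

In a finite-dimensional subspace of `L²(0,1)`, density of test functions becomes uniform: each
element is a test function up to a small relative error, with derivative controlled by its norm.
Gluing over the cells writes `f` as a small remainder plus a test function `s` with `‖s'‖ ≤ C 2ᴿ
‖f‖` (`exists_testFun_approx_of_cells`). The upper frame bound controls the samples of the
remainder; applied to `s'` it bounds those of `s` at frequencies beyond `K 2ᴿ`
(`IsFourierFrame.exists_sum_sample_le`).

Finally, the upper frame bound tested on exponentials prevents the `ω n` from clustering, so `|ω n|`
grows at least linearly (`IsFourierFrame.exists_growth`), and `N ≥ c₀ 2ᴿ` puts all omitted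
frequencies beyond `K 2ᴿ`. -/

theorem norm_sq_eq_integral {μ : Measure ℝ} (u : Lp ℂ 2 μ) : ‖u‖ ^ 2 = ∫ x, ‖u x‖ ^ 2 ∂μ := by
  have h : ⟪u, u⟫_ℂ = ((∫ x, ‖u x‖ ^ 2 ∂μ : ℝ) : ℂ) := by
    rw [L2.inner_def, ← integral_complex_ofReal]
    refine integral_congr_ae (Filter.Eventually.of_forall fun x => ?_)
    simp only [inner_self_eq_norm_sq_to_K]
    push_cast
    rfl
  rw [← inner_self_eq_norm_sq (𝕜 := ℂ) u, h]
  rfl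

/-- If the first projection of `G` is dense, the elements of a finite-dimensional space are
approximated by it with a linear control of the second component. -/
theorem exists_approx_of_finiteDimensional {E F : Type*} [NormedAddCommGroup E] [NormedSpace ℂ E]
    [NormedAddCommGroup F] [NormedSpace ℂ F] (G : Submodule ℂ (E × F))
    (hG : ∀ x : E, ∀ η > 0, ∃ g ∈ G, ‖x - g.1‖ < η) (N : Submodule ℂ E) [FiniteDimensional ℂ N]
    {δ : ℝ} (hδ : 0 < δ) :
    ∃ C, 0 ≤ C ∧ ∀ y ∈ N, ∃ g ∈ G, ‖y - g.1‖ ≤ δ * ‖y‖ ∧ ‖g.2‖ ≤ C * ‖y‖ := by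
  classical
  let b := Module.finBasis ℂ N
  let L := LinearMap.toContinuousLinearMap (b.equivFun : N →ₗ[ℂ] (Fin (Module.finrank ℂ N) → ℂ))
  -- The coordinates of `y` are at most `‖L‖‖y‖`, so approximating each basis vector within `η`
  -- costs `dim * ‖L‖ * η * ‖y‖` in total; the two `+ 1` keep the denominator positive.
  have hη : 0 < δ / ((Module.finrank ℂ N + 1) * (‖L‖ + 1)) := by positivity
  choose g hg hgη using fun i => hG (b i : E) _ hη
  have hc : ∀ (y : N) i, ‖b.equivFun y i‖ ≤ ‖L‖ * ‖y‖ := fun y i =>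
    (norm_le_pi_norm (L y) i).trans (L.le_opNorm y)
  refine ⟨∑ i, ‖L‖ * ‖(g i).2‖, by positivity, fun y hy => ?_⟩
  refine ⟨∑ i, b.equivFun ⟨y, hy⟩ i • g i, G.sum_mem fun i _ => G.smul_mem _ (hg i), ?_, ?_⟩
  · have h1 : y = ∑ i, b.equivFun ⟨y, hy⟩ i • (b i : E) := by
      conv_lhs => rw [show y = ((⟨y, hy⟩ : N) : E) from rfl, ← b.sum_equivFun ⟨y, hy⟩]
      push_cast
      rfl
    have h2 : y - (∑ i, b.equivFun ⟨y, hy⟩ i • g i).1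
        = ∑ i, b.equivFun ⟨y, hy⟩ i • ((b i : E) - (g i).1) := by
      refine (congrArg (· - (∑ i, b.equivFun ⟨y, hy⟩ i • g i).1) h1).trans ?_
      simp only [Prod.fst_sum, Prod.smul_fst, smul_sub, Finset.sum_sub_distrib]
    rw [h2]
    refine (norm_sum_le _ _).trans ?_
    have h3 : ∀ i ∈ Finset.univ, ‖b.equivFun ⟨y, hy⟩ i • ((b i : E) - (g i).1)‖ ≤
        (‖L‖ * ‖y‖) * (δ / ((Module.finrank ℂ N + 1) * (‖L‖ + 1))) := fun i _ => by
      rw [norm_smul]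
      exact mul_le_mul (hc ⟨y, hy⟩ i) (hgη i).le (norm_nonneg _) (by positivity)
    refine (Finset.sum_le_sum h3).trans ?_
    rw [Finset.sum_const, Finset.card_univ, Fintype.card_fin, nsmul_eq_mul]
    have h4 : (Module.finrank ℂ N : ℝ) * ‖L‖ ≤ (Module.finrank ℂ N + 1) * (‖L‖ + 1) := by
      gcongr <;> linarith
    have h5 : (Module.finrank ℂ N : ℝ) * (‖L‖ * ‖y‖ * (δ / ((Module.finrank ℂ N + 1) * (‖L‖ + 1))))
        = (δ * ‖y‖) * ((Module.finrank ℂ N * ‖L‖) / ((Module.finrank ℂ N + 1) * (‖L‖ + 1))) := by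
      ring
    rw [h5]
    exact mul_le_of_le_one_right (by positivity) ((div_le_one (by positivity)).2 h4)
  · rw [Prod.snd_sum, Finset.sum_mul]
    refine (norm_sum_le _ _).trans (Finset.sum_le_sum fun i _ => ?_)
    rw [Prod.smul_snd, norm_smul, mul_right_comm]
    exact mul_le_mul_of_nonneg_right (hc ⟨y, hy⟩ i) (norm_nonneg _)

/-- Continuously differentiable functions with compact support in `(0,1)`. -/
structure IsTestFun (s : ℝ → ℂ) : Prop where
  contDiff : ContDiff ℝ 1 s
  compact : HasCompactSupport s
  subset : tsupport s ⊆ Ioo (0 : ℝ) 1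

theorem IsTestFun.memLp {s : ℝ → ℂ} (hs : IsTestFun s) (p : ENNReal) (μ : Measure ℝ)
    [IsFiniteMeasureOnCompacts μ] : MemLp s p μ :=
  hs.contDiff.continuous.memLp_of_hasCompactSupport hs.compact

theorem IsTestFun.memLp_deriv {s : ℝ → ℂ} (hs : IsTestFun s) (p : ENNReal) (μ : Measure ℝ)
    [IsFiniteMeasureOnCompacts μ] : MemLp (deriv s) p μ :=
  (hs.contDiff.continuous_deriv le_rfl).memLp_of_hasCompactSupport hs.compact.deriv

theorem IsTestFun.zero : IsTestFun 0 where
  contDiff := contDiff_const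
  compact := HasCompactSupport.zero
  subset := by simp [tsupport]

theorem IsTestFun.add {s t : ℝ → ℂ} (hs : IsTestFun s) (ht : IsTestFun t) : IsTestFun (s + t) where
  contDiff := hs.contDiff.add ht.contDiff
  compact := hs.compact.add ht.compact
  subset := (tsupport_add s t).trans (union_subset hs.subset ht.subset)

theorem IsTestFun.smul {s : ℝ → ℂ} (hs : IsTestFun s) (c : ℂ) : IsTestFun (c • s) where
  contDiff := hs.contDiff.const_smul c
  compact := hs.compact.smul_left (f := fun _ => c)
  subset := (tsupport_smul_subset_right (fun _ => c) s).trans hs.subset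

/-- The graph of the derivative on test functions. -/
def testGraph : Submodule ℂ (Lp ℂ 2 (volume.restrict (Ioo (0 : ℝ) 1)) ×
    Lp ℂ 2 (volume.restrict (Ioo (0 : ℝ) 1))) where
  carrier := {g | ∃ s, IsTestFun s ∧ g.1 =ᵐ[volume.restrict (Ioo (0 : ℝ) 1)] s ∧
    g.2 =ᵐ[volume.restrict (Ioo (0 : ℝ) 1)] deriv s}
  zero_mem' := by
    refine ⟨0, IsTestFun.zero, Lp.coeFn_zero _ _ _, ?_⟩
    have : deriv (0 : ℝ → ℂ) = 0 := by ext x; exact deriv_const x (0 : ℂ)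
    rw [this]
    exact Lp.coeFn_zero _ _ _
  add_mem' := by
    rintro ⟨a, a'⟩ ⟨b, b'⟩ ⟨s, hs, hs1, hs2⟩ ⟨t, ht, ht1, ht2⟩
    refine ⟨s + t, hs.add ht, (Lp.coeFn_add a b).trans (hs1.add ht1), ?_⟩
    have : deriv (s + t) = deriv s + deriv t := by
      ext x
      exact deriv_add (hs.contDiff.differentiable one_ne_zero x)
        (ht.contDiff.differentiable one_ne_zero x)
    rw [this]
    exact (Lp.coeFn_add a' b').trans (hs2.add ht2)
  smul_mem' := by
    rintro c ⟨a, a'⟩ ⟨s, hs, hs1, hs2⟩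
    refine ⟨c • s, hs.smul c, (Lp.coeFn_smul c a).trans (hs1.const_smul c), ?_⟩
    have : deriv (c • s) = c • deriv s := by
      ext x
      exact deriv_const_smul c (hs.contDiff.differentiable one_ne_zero x)
    rw [this]
    exact (Lp.coeFn_smul c a').trans (hs2.const_smul c)

/-- A `v` orthogonal to all test functions vanishes by the fundamental lemma of the calculus of
variations, so the test functions have trivial orthogonal complement. -/
theorem testGraph_dense (u : Lp ℂ 2 (volume.restrict (Ioo (0 : ℝ) 1))) (η : ℝ) (hη : 0 < η) :
    ∃ g ∈ testGraph, ‖u - g.1‖ < η := by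
  have key : (testGraph.map (LinearMap.fst ℂ _ _)).topologicalClosure = ⊤ := by
    rw [Submodule.topologicalClosure_eq_top_iff, Submodule.eq_bot_iff]
    intro v hv
    rw [Submodule.mem_orthogonal] at hv
    have hint : Integrable v (volume.restrict (Ioo (0 : ℝ) 1)) :=
      ((Lp.memLp v).mono_exponent (by norm_num : (1 : ENNReal) ≤ 2)).integrable le_rfl
    have hloc : LocallyIntegrableOn v (Ioo (0 : ℝ) 1) volume :=
      IntegrableOn.locallyIntegrableOn hint
    have h0 := isOpen_Ioo.ae_eq_zero_of_integral_contDiff_smul_eq_zero hloc fun g hg hgc hgs => by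
      let s : ℝ → ℂ := fun x => (g x : ℂ)
      have hts : tsupport s ⊆ tsupport g := by
        refine closure_mono fun x hx => ?_
        simpa [s] using hx
      have hs : IsTestFun s :=
        ⟨(Complex.ofRealCLM.contDiff.comp hg).of_le (by exact_mod_cast le_top),
          hgc.mono' (subset_closure.trans hts), hts.trans hgs⟩
      have m1 := hs.memLp 2 (volume.restrict (Ioo (0 : ℝ) 1))
      have m2 := hs.memLp_deriv 2 (volume.restrict (Ioo (0 : ℝ) 1))
      have hm := hv (m1.toLp s) ⟨(m1.toLp s, m2.toLp (deriv s)), ⟨s, hs, m1.coeFn_toLp, m2.coeFn_toLp⟩, rfl⟩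
      rw [L2.inner_def] at hm
      have hsub : ∫ x, g x • v x = ∫ x in Ioo (0 : ℝ) 1, g x • v x := by
        refine (setIntegral_eq_integral_of_forall_compl_eq_zero fun x hx => ?_).symm
        rw [image_eq_zero_of_notMem_tsupport fun h => hx (hgs h), zero_smul]
      rw [hsub, ← hm]
      refine integral_congr_ae ?_
      filter_upwards [m1.coeFn_toLp] with x hx
      rw [hx, RCLike.inner_apply, Complex.real_smul]
      simp [s, mul_comm]
    rw [Lp.eq_zero_iff_ae_eq_zero, Filter.EventuallyEq, ae_restrict_iff' measurableSet_Ioo]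
    exact h0
  have hu : u ∈ (testGraph.map (LinearMap.fst ℂ _ _)).topologicalClosure := key ▸ Submodule.mem_top
  obtain ⟨w, ⟨g, hg, rfl⟩, hw⟩ := Metric.mem_closure_iff.1 hu η hη
  exact ⟨g, hg, by rwa [dist_eq_norm] at hw⟩

/-- The constant `C` depends on `N` and `δ` only; this uniformity over `N` is what finite dimension
buys. -/
theorem exists_testFun_approx (N : Submodule ℂ (Lp ℂ 2 (volume.restrict (Ioo (0 : ℝ) 1))))
    [FiniteDimensional ℂ N] {δ : ℝ} (hδ : 0 < δ) :
    ∃ C, 0 ≤ C ∧ ∀ u ∈ N, ∃ s, IsTestFun s ∧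
      ∫ x in Ioo (0 : ℝ) 1, ‖u x - s x‖ ^ 2 ≤ δ * ∫ x in Ioo (0 : ℝ) 1, ‖u x‖ ^ 2 ∧
      ∫ x in Ioo (0 : ℝ) 1, ‖deriv s x‖ ^ 2 ≤ C * ∫ x in Ioo (0 : ℝ) 1, ‖u x‖ ^ 2 := by
  obtain ⟨C, hC, h⟩ := exists_approx_of_finiteDimensional testGraph testGraph_dense N
    (Real.sqrt_pos.2 hδ)
  refine ⟨C ^ 2, by positivity, fun u hu => ?_⟩
  obtain ⟨⟨a, a'⟩, ⟨s, hs, h1, h2⟩, h3, h4⟩ := h u hu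
  refine ⟨s, hs, ?_, ?_⟩
  · have e : ∫ x in Ioo (0 : ℝ) 1, ‖u x - s x‖ ^ 2 = ‖u - a‖ ^ 2 := by
      rw [norm_sq_eq_integral]
      refine integral_congr_ae ?_
      filter_upwards [h1, Lp.coeFn_sub u a] with x hx hx'
      rw [hx', Pi.sub_apply, hx]
    rw [e, ← norm_sq_eq_integral]
    calc ‖u - a‖ ^ 2 ≤ (√δ * ‖u‖) ^ 2 := by gcongr
      _ = δ * ‖u‖ ^ 2 := by rw [mul_pow, Real.sq_sqrt hδ.le]
  · have e : ∫ x in Ioo (0 : ℝ) 1, ‖deriv s x‖ ^ 2 = ‖a'‖ ^ 2 := by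
      rw [norm_sq_eq_integral]
      refine integral_congr_ae ?_
      filter_upwards [h2] with x hx
      rw [hx]
    rw [e, ← norm_sq_eq_integral, ← mul_pow]
    gcongr

/-! ### Elements of `H` as functions -/

theorem norm_sq_H (f : H) : ‖f‖ ^ 2 = ∫ x in Ioo (0 : ℝ) 1, ‖(f : L2) x‖ ^ 2 := by
  rw [← integral_Ioc_eq_integral_Ioo, ← integral_Icc_eq_integral_Ioc,
    setIntegral_eq_integral_of_ae_compl_eq_zero]
  · exact norm_sq_eq_integral (f : L2)
  · filter_upwards [f.2] with x hx h
    rw [hx h, norm_zero, zero_pow two_ne_zero]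

theorem restr_coeFn {g : ℝ → ℂ} (hg : MemLp ((Icc (0 : ℝ) 1).indicator g) 2 volume) :
    ((restr g : L2) : ℝ → ℂ) =ᵐ[volume] (Icc (0 : ℝ) 1).indicator g :=
  toL2_coeFn hg

theorem restr_coeFn_Ioo {g : ℝ → ℂ} (hg : MemLp ((Icc (0 : ℝ) 1).indicator g) 2 volume) :
    ((restr g : L2) : ℝ → ℂ) =ᵐ[volume.restrict (Ioo (0 : ℝ) 1)] g := by
  rw [Filter.EventuallyEq, ae_restrict_iff' measurableSet_Ioo]
  filter_upwards [restr_coeFn hg] with x hx h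
  rw [hx, indicator_of_mem (Ioo_subset_Icc_self h)]

theorem norm_expFun (w x : ℝ) : ‖expFun w x‖ = 1 := by
  have : expFun w x = Complex.exp ((2 * Real.pi * w * x : ℝ) * Complex.I) := by
    unfold expFun; push_cast; ring_nf
  rw [this, Complex.norm_exp_ofReal_mul_I]

theorem norm_restr_expFun (w : ℝ) : ‖restr (expFun w)‖ = 1 := by
  have h : ‖restr (expFun w)‖ ^ 2 = 1 := by
    rw [norm_sq_H]
    calc _ = ∫ x in Ioo (0 : ℝ) 1, (1 : ℝ) := by
          refine integral_congr_ae ?_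
          filter_upwards [restr_coeFn_Ioo (memLp_expFun w)] with x hx
          rw [hx, norm_expFun, one_pow]
      _ = 1 := by simp
  exact (pow_eq_one_iff_of_nonneg (norm_nonneg _) two_ne_zero).1 h

theorem norm_expFun_sub_le (v w : ℝ) {x : ℝ} (hx : x ∈ Ioo (0 : ℝ) 1) :
    ‖expFun v x - expFun w x‖ ≤ 2 * Real.pi * |v - w| := by
  have h : expFun v x - expFun w x
      = expFun w x * (Complex.exp (Complex.I * (2 * Real.pi * (v - w) * x : ℝ)) - 1) := by
    unfold expFun
    rw [mul_sub, mul_one, ← Complex.exp_add]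
    congr 2
    push_cast
    ring
  rw [h, norm_mul, norm_expFun, one_mul]
  refine Real.norm_exp_I_mul_ofReal_sub_one_le.trans ?_
  rw [Real.norm_eq_abs, abs_mul, abs_mul, abs_of_pos Real.two_pi_pos, abs_of_pos hx.1]
  exact mul_le_of_le_one_right (by positivity) hx.2.le

theorem norm_restr_expFun_sub_le (v w : ℝ) :
    ‖restr (expFun v) - restr (expFun w)‖ ≤ 2 * Real.pi * |v - w| := by
  refine abs_le_of_sq_le_sq' ?_ (by positivity) |>.2
  rw [norm_sq_H]
  have hb : ∀ᵐ x ∂(volume.restrict (Ioo (0 : ℝ) 1)),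
      ‖((restr (expFun v) - restr (expFun w) : H) : L2) x‖ ^ 2 ≤ (2 * Real.pi * |v - w|) ^ 2 := by
    filter_upwards [restr_coeFn_Ioo (memLp_expFun v), restr_coeFn_Ioo (memLp_expFun w),
      ae_restrict_of_ae (Lp.coeFn_sub (restr (expFun v) : L2) (restr (expFun w) : L2)),
      ae_restrict_mem measurableSet_Ioo] with x h1 h2 h3 h4
    rw [Submodule.coe_sub, h3, Pi.sub_apply, h1, h2]
    gcongr
    exact norm_expFun_sub_le v w h4
  refine (integral_mono_of_nonneg (Filter.Eventually.of_forall fun _ => by positivity)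
    (integrable_const _) hb).trans ?_
  simp

/-- The sample is exactly `1` when `v = w`, and moving the frequency by `|v - w|` moves the
exponential by at most `2π|v - w| ≤ 1/2` in norm. -/
theorem half_le_norm_sample {v w : ℝ} (h : |v - w| ≤ 1 / (4 * Real.pi)) :
    1 / 2 ≤ ‖sample v (restr (expFun w))‖ := by
  have h1 : sample v (restr (expFun w))
      = 1 - ⟪restr (expFun w) - restr (expFun v), restr (expFun w)⟫_ℂ := by
    rw [sample_apply, ← inner_restr_expFun, inner_sub_left, inner_self_eq_norm_sq_to_K,
      norm_restr_expFun]
    simp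
  have h2 : ‖⟪restr (expFun w) - restr (expFun v), restr (expFun w)⟫_ℂ‖ ≤ 1 / 2 := by
    refine (norm_inner_le_norm (𝕜 := ℂ) (restr (expFun w) - restr (expFun v)) (restr (expFun w))).trans ?_
    rw [norm_restr_expFun, mul_one, norm_sub_rev]
    refine (norm_restr_expFun_sub_le v w).trans ?_
    calc 2 * Real.pi * |v - w| ≤ 2 * Real.pi * (1 / (4 * Real.pi)) := by gcongr
      _ = 1 / 2 := by field_simp; norm_num
  rw [h1]
  have h3 := norm_sub_norm_le (1 : ℂ) ⟪restr (expFun w) - restr (expFun v), restr (expFun w)⟫_ℂ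
  rw [norm_one] at h3
  linarith

/-! ### Growth of the sampling points -/

theorem IsFourierFrame.sum_le {ω : ℤ → ℝ} {A B : ℝ} (h : IsFourierFrame ω A B) (f : H)
    (s : Finset ℤ) : ∑ n ∈ s, ‖sample (ω n) f‖ ^ 2 ≤ B * ‖f‖ ^ 2 :=
  ((h.2 f).1.sum_le_tsum s fun _ _ => by positivity).trans (h.2 f).2.2

theorem IsFourierFrame.pos {ω : ℤ → ℝ} {A B : ℝ} (h : IsFourierFrame ω A B) : 0 < B := by
  have h1 := (h.2 (restr (expFun 0))).2
  rw [norm_restr_expFun] at h1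
  have := h.1
  linarith [h1.1.trans h1.2]

/-- In the upper frame bound for the unit vector `restr (expFun w)`, each nearby `ω n` contributes
at least `1/4`. -/
theorem IsFourierFrame.card_le {ω : ℤ → ℝ} {A B : ℝ} (h : IsFourierFrame ω A B) (w : ℝ)
    (s : Finset ℤ) (hs : ∀ n ∈ s, |ω n - w| ≤ 1 / (4 * Real.pi)) : (s.card : ℝ) ≤ 4 * B := by
  have h1 := h.sum_le (restr (expFun w)) s
  have h2 : ∑ n ∈ s, (1 / 4 : ℝ) ≤ ∑ n ∈ s, ‖sample (ω n) (restr (expFun w))‖ ^ 2 := by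
    refine Finset.sum_le_sum fun n hn => ?_
    have := half_le_norm_sample (hs n hn)
    nlinarith
  rw [Finset.sum_const, nsmul_eq_mul] at h2
  rw [norm_restr_expFun] at h1
  linarith

/-- With `m > 4B`, a failure of the gap would put the `m + 1` points `ω n, …, ω (n + m)` in one
window, against `card_le`. -/
theorem IsFourierFrame.exists_gap {ω : ℤ → ℝ} {A B : ℝ} (h : IsFourierFrame ω A B)
    (hω : Monotone ω) : ∃ m : ℕ, 0 < m ∧ ∀ n : ℤ, ω n + 1 / (4 * Real.pi) ≤ ω (n + m) := by
  obtain ⟨m, hm⟩ := exists_nat_gt (4 * B)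
  have hm0 : 0 < m := by
    have := h.pos
    exact_mod_cast (by linarith : (0 : ℝ) < m)
  refine ⟨m, hm0, fun n => ?_⟩
  by_contra hlt
  push Not at hlt
  have hc := h.card_le (ω n) (Finset.Icc n (n + m)) fun k hk => by
    rw [Finset.mem_Icc] at hk
    rw [abs_of_nonneg (sub_nonneg.2 (hω hk.1))]
    have := hω hk.2
    linarith
  rw [Int.card_Icc, show n + (m : ℤ) + 1 - n = ((m + 1 : ℕ) : ℤ) by push_cast; ring,
    Int.toNat_natCast] at hc
  push_cast at hc
  linarith

theorem IsFourierFrame.exists_growth {ω : ℤ → ℝ} {A B : ℝ} (h : IsFourierFrame ω A B)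
    (hω : Monotone ω) : ∃ a b : ℝ, 0 < a ∧ ∀ (N : ℕ) (n : ℤ), n ∉ Finset.Icc (-(N : ℤ)) N →
      a * N - b ≤ |ω n| := by
  obtain ⟨m, hm, hgap⟩ := h.exists_gap hω
  set r : ℝ := 1 / (4 * Real.pi) with hr
  have hr0 : 0 < r := by positivity
  have up : ∀ q : ℕ, ω 0 + q * r ≤ ω (q * m) := by
    intro q
    induction q with
    | zero => simp
    | succ q ih =>
      have := hgap (q * m)
      rw [show ((q + 1 : ℕ) : ℤ) * (m : ℤ) = q * m + m by push_cast; ring]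
      push_cast
      linarith
  have down : ∀ q : ℕ, ω (-(q * m)) ≤ ω 0 - q * r := by
    intro q
    induction q with
    | zero => simp
    | succ q ih =>
      have := hgap (-(q * m) - m)
      rw [sub_add_cancel] at this
      rw [show -(((q + 1 : ℕ) : ℤ) * (m : ℤ)) = -(q * m) - m by push_cast; ring]
      push_cast
      linarith
  have hm' : (0 : ℝ) < m := by exact_mod_cast hm
  -- Each block of `m` indices advances by at least `r`. In the second constant, `r` pays for
  -- rounding `N / m` down and `|ω 0|` for the starting point.
  refine ⟨r / m, r + |ω 0|, by positivity, fun N n hn => ?_⟩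
  have hdiv : (N : ℝ) / m - 1 ≤ (N / m : ℕ) := by
    have := Nat.lt_div_mul_add (a := N) hm
    rw [div_sub_one hm'.ne', div_le_iff₀ hm']
    have h2 : (N : ℝ) < (N / m : ℕ) * m + m := by exact_mod_cast this
    linarith
  have hq : r / m * N - r ≤ (N / m : ℕ) * r := by
    calc r / m * N - r = ((N : ℝ) / m - 1) * r := by field_simp
      _ ≤ _ := by gcongr
  have hle : ((N / m : ℕ) : ℤ) * m ≤ N := by exact_mod_cast Nat.div_mul_le_self N m
  rw [Finset.mem_Icc, not_and_or] at hn
  rcases hn with hn | hn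
  · have h1 := hω (show n ≤ -(((N / m : ℕ) : ℤ) * m) by omega)
    have := down (N / m)
    have := neg_abs_le (ω n)
    have := le_abs_self (ω 0)
    linarith
  · have h1 := hω (show ((N / m : ℕ) : ℤ) * m ≤ n by omega)
    have := up (N / m)
    have := le_abs_self (ω n)
    have := neg_abs_le (ω 0)
    linarith

/-! ### Decay of the samples of a test function -/

theorem IsTestFun.eq_zero {s : ℝ → ℂ} (hs : IsTestFun s) {x : ℝ} (hx : x ∉ Ioo (0 : ℝ) 1) :
    s x = 0 :=
  image_eq_zero_of_notMem_tsupport fun h => hx (hs.subset h)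

theorem IsTestFun.deriv_eq_zero {s : ℝ → ℂ} (hs : IsTestFun s) {x : ℝ} (hx : x ∉ Ioo (0 : ℝ) 1) :
    deriv s x = 0 :=
  Function.notMem_support.1 fun h => hx (hs.subset (support_deriv_subset h))

theorem indicator_Icc_eq_self {g : ℝ → ℂ} (hg : ∀ x, x ∉ Ioo (0 : ℝ) 1 → g x = 0) :
    (Icc (0 : ℝ) 1).indicator g = g :=
  indicator_eq_self.2 fun x hx => Ioo_subset_Icc_self (by_contra fun h => hx (hg x h))

theorem sample_restr {g : ℝ → ℂ} (hg : ∀ x, x ∉ Ioo (0 : ℝ) 1 → g x = 0)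
    (hL : MemLp g 2 volume) (w : ℝ) : sample w (restr g) = 𝓕 g w := by
  have h := restr_coeFn (g := g) ((indicator_Icc_eq_self hg).symm ▸ hL)
  rw [indicator_Icc_eq_self hg] at h
  rw [sample_apply, Real.fourier_eq', Real.fourier_eq']
  refine integral_congr_ae ?_
  filter_upwards [h] with x hx
  rw [hx]

/-- Integration by parts has no boundary terms, since the support lies strictly inside `(0,1)`; this
is why approximants vanish near the endpoints. -/
theorem IsTestFun.sample_deriv {s : ℝ → ℂ} (hs : IsTestFun s) (w : ℝ) :
    sample w (restr (deriv s)) = 2 * Real.pi * Complex.I * w * sample w (restr s) := by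
  rw [sample_restr (fun _ => hs.deriv_eq_zero) (hs.memLp_deriv 2 _),
    sample_restr (fun _ => hs.eq_zero) (hs.memLp 2 _),
    Real.fourier_deriv (memLp_one_iff_integrable.1 (hs.memLp 1 _))
      (hs.contDiff.differentiable one_ne_zero) (memLp_one_iff_integrable.1 (hs.memLp_deriv 1 _))]
  rfl

/-- The upper frame bound is applied to `deriv s`, whose sample at `ω n` is that of `s` multiplied
by `2πi ω n`, of modulus at least `M`. -/
theorem IsTestFun.sum_sample_le {s : ℝ → ℂ} (hs : IsTestFun s) {ω : ℤ → ℝ} {A B : ℝ}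
    (h : IsFourierFrame ω A B) {M : ℝ} (hM : 0 < M) (t : Finset ℤ) (ht : ∀ n ∈ t, M ≤ |ω n|) :
    ∑ n ∈ t, ‖sample (ω n) (restr s)‖ ^ 2 ≤ B * ‖restr (deriv s)‖ ^ 2 / M ^ 2 := by
  rw [le_div_iff₀ (by positivity), Finset.sum_mul]
  refine le_trans (Finset.sum_le_sum fun n hn => ?_) (h.sum_le (restr (deriv s)) t)
  rw [← mul_pow, hs.sample_deriv, norm_mul, mul_comm]
  have h1 : M ≤ ‖(2 * Real.pi * Complex.I * ω n : ℂ)‖ := by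
    simp only [norm_mul, Complex.norm_ofNat, Complex.norm_I, Complex.norm_real, Real.norm_eq_abs,
      abs_of_pos Real.pi_pos, mul_one]
    have := ht n hn
    have := Real.pi_gt_three
    nlinarith [abs_nonneg (ω n)]
  gcongr

/-! ### Functions made of rescaled pieces -/

theorem setIntegral_eq_sum_cells {g : ℝ → ℝ} (hg : IntegrableOn g (Ioo (0 : ℝ) 1)) {M : ℕ}
    (hM : 0 < M) : ∫ x in Ioo (0 : ℝ) 1, g x =
      ∑ i ∈ Finset.range M, (M : ℝ)⁻¹ * ∫ x in Ioo (0 : ℝ) 1, g ((x + i) / M) := by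
  have hM' : (0 : ℝ) < M := by exact_mod_cast hM
  have hI : IntervalIntegrable g volume 0 1 :=
    (intervalIntegrable_iff_integrableOn_Ioo_of_le zero_le_one).2 hg
  have h := intervalIntegral.sum_integral_adjacent_intervals (f := g) (μ := volume)
    (a := fun i : ℕ => (i : ℝ) / M) (n := M) fun k hk => by
      refine hI.mono_set ?_
      rw [uIcc_of_le zero_le_one, uIcc_of_le (by gcongr; exact_mod_cast k.le_succ)]
      refine Icc_subset_Icc (by positivity) ((div_le_one hM').2 (by exact_mod_cast hk))
  have e : ∀ u : ℝ → ℝ, ∫ x in Ioo (0 : ℝ) 1, u x = ∫ x in (0 : ℝ)..1, u x := fun u => by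
    rw [intervalIntegral.integral_of_le zero_le_one, integral_Ioc_eq_integral_Ioo]
  rw [e]
  simp only [e]
  rw [Nat.cast_zero, zero_div, div_self hM'.ne'] at h
  rw [← h]
  refine Finset.sum_congr rfl fun i _ => ?_
  have h2 := intervalIntegral.integral_comp_mul_add (a := 0) (b := 1) g
    (inv_ne_zero hM'.ne') ((i : ℝ) / M)
  rw [inv_inv, smul_eq_mul, mul_zero, zero_add, mul_one] at h2
  have h3 : ∀ x : ℝ, g ((x + i) / M) = g ((M : ℝ)⁻¹ * x + i / M) := fun x => by
    congr 1; ring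
  simp only [h3, h2]
  rw [inv_mul_cancel_left₀ hM'.ne']
  congr 1
  push_cast
  ring

/-- For `i < M` the cell `(i/M, (i+1)/M)` lies in `(0,1)`, and the rescaled function is supported
inside it. -/
theorem IsTestFun.rescale {s : ℝ → ℂ} (hs : IsTestFun s) {M i : ℕ} (hi : i < M) :
    IsTestFun fun x => s (M * x - i) := by
  have hsub : tsupport (fun x => s (M * x - i)) ⊆ Ioo (0 : ℝ) 1 := by
    intro x hx
    have h := hs.subset (tsupport_comp_subset_preimage s
      (f := fun x : ℝ => (M : ℝ) * x - i) (by fun_prop) hx)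
    have hi' : (i : ℝ) + 1 ≤ M := by exact_mod_cast hi
    have hM : (0 : ℝ) < M := by linarith [Nat.cast_nonneg (α := ℝ) i]
    have h0 : (0 : ℝ) ≤ i := by positivity
    obtain ⟨h1, h2⟩ := h
    constructor
    · by_contra hx'
      push Not at hx'
      nlinarith [mul_nonpos_of_nonneg_of_nonpos hM.le hx']
    · by_contra hx'
      push Not at hx'
      nlinarith [mul_le_mul_of_nonneg_left hx' hM.le]
  exact ⟨hs.contDiff.comp (by fun_prop),
    isCompact_Icc.of_isClosed_subset (isClosed_tsupport _) (hsub.trans Ioo_subset_Icc_self), hsub⟩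

theorem IsTestFun.sum {ι : Type*} {t : Finset ι} {s : ι → ℝ → ℂ}
    (hs : ∀ i ∈ t, IsTestFun (s i)) : IsTestFun (∑ i ∈ t, s i) :=
  Finset.sum_induction _ IsTestFun (fun _ _ => IsTestFun.add) IsTestFun.zero hs

theorem sum_cells_apply {s : ℕ → ℝ → ℂ} (hs : ∀ i x, x ∉ Ioo (0 : ℝ) 1 → s i x = 0) {M i : ℕ}
    (hi : i < M) {x : ℝ} (hx : x ∈ Ioo (0 : ℝ) 1) :
    ∑ k ∈ Finset.range M, s k (M * ((x + i) / M) - k) = s i x := by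
  have hM : (M : ℝ) ≠ 0 := by
    have : 0 < M := by omega
    positivity
  rw [Finset.sum_eq_single_of_mem i (Finset.mem_range.2 hi)]
  · rw [mul_div_cancel₀ _ hM, add_sub_cancel_right]
  · intro k _ hk
    refine hs k _ fun hm => ?_
    rw [mul_div_cancel₀ _ hM] at hm
    rcases lt_or_gt_of_ne hk with h | h
    · have : (k : ℝ) + 1 ≤ i := by exact_mod_cast h
      linarith [hm.2, hx.1]
    · have : (i : ℝ) + 1 ≤ k := by exact_mod_cast h
      linarith [hm.1, hx.2]

theorem integrableOn_norm_sq (f : L2) : IntegrableOn (fun x => ‖f x‖ ^ 2) (Ioo (0 : ℝ) 1) :=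
  ((Lp.memLp f).integrable_norm_pow two_ne_zero).integrableOn

theorem norm_sq_H_eq_sum (f : H) {M : ℕ} (hM : 0 < M) : ‖f‖ ^ 2 =
    ∑ i ∈ Finset.range M, (M : ℝ)⁻¹ * ∫ x in Ioo (0 : ℝ) 1, ‖(f : L2) ((x + i) / M)‖ ^ 2 := by
  rw [norm_sq_H]
  exact setIntegral_eq_sum_cells (integrableOn_norm_sq _) hM

theorem quasiMeasurePreserving_affine {a : ℝ} (ha : a ≠ 0) (b : ℝ) :
    Measure.QuasiMeasurePreserving (fun x : ℝ => a * x + b) volume volume :=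
  (measurePreserving_add_right volume b).quasiMeasurePreserving.comp
    (Measure.quasiMeasurePreserving_smul volume ha)

theorem quasiMeasurePreserving_cell {M : ℝ} (hM : M ≠ 0) (b : ℝ) :
    Measure.QuasiMeasurePreserving (fun x : ℝ => (x + b) / M) volume volume := by
  convert quasiMeasurePreserving_affine (inv_ne_zero hM) (b / M) using 2
  ring

/-- A function whose rescaled pieces on the intervals `(i/M, (i+1)/M)` belong to a
finite-dimensional space is approximated by a test function, with a Bernstein inequality. -/
theorem exists_testFun_approx_of_cells
    (N : Submodule ℂ (Lp ℂ 2 (volume.restrict (Ioo (0 : ℝ) 1)))) [FiniteDimensional ℂ N]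
    {δ : ℝ} (hδ : 0 < δ) :
    ∃ C, 0 ≤ C ∧ ∀ (M : ℕ) (f : H), 0 < M →
      (∀ i < M, ∃ u ∈ N, ∀ᵐ x ∂(volume.restrict (Ioo (0 : ℝ) 1)),
        (f : L2) ((x + i) / M) = u x) →
      ∃ s, IsTestFun s ∧ ‖f - restr s‖ ^ 2 ≤ δ * ‖f‖ ^ 2 ∧
        ‖restr (deriv s)‖ ^ 2 ≤ C * M ^ 2 * ‖f‖ ^ 2 := by
  obtain ⟨C, hC, h⟩ := exists_testFun_approx N hδ
  refine ⟨C, hC, fun M f hM hf => ?_⟩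
  have hM' : (0 : ℝ) < M := by exact_mod_cast hM
  -- Indices `i ≥ M` receive the zero function, so that a sequence of test functions can be chosen
  -- on all of `ℕ`.
  have hex : ∀ i : ℕ, ∃ s, IsTestFun s ∧ (i < M →
      ∫ x in Ioo (0 : ℝ) 1, ‖(f : L2) ((x + i) / M) - s x‖ ^ 2
        ≤ δ * ∫ x in Ioo (0 : ℝ) 1, ‖(f : L2) ((x + i) / M)‖ ^ 2 ∧
      ∫ x in Ioo (0 : ℝ) 1, ‖deriv s x‖ ^ 2
        ≤ C * ∫ x in Ioo (0 : ℝ) 1, ‖(f : L2) ((x + i) / M)‖ ^ 2) := by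
    intro i
    by_cases hi : i < M
    · obtain ⟨u, hu, hfu⟩ := hf i hi
      obtain ⟨s, hs, h1, h2⟩ := h u hu
      refine ⟨s, hs, fun _ => ?_⟩
      have e1 : ∫ x in Ioo (0 : ℝ) 1, ‖(f : L2) ((x + i) / M)‖ ^ 2
          = ∫ x in Ioo (0 : ℝ) 1, ‖u x‖ ^ 2 := by
        refine integral_congr_ae ?_
        filter_upwards [hfu] with x hx
        rw [hx]
      have e2 : ∫ x in Ioo (0 : ℝ) 1, ‖(f : L2) ((x + i) / M) - s x‖ ^ 2
          = ∫ x in Ioo (0 : ℝ) 1, ‖u x - s x‖ ^ 2 := by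
        refine integral_congr_ae ?_
        filter_upwards [hfu] with x hx
        rw [hx]
      rw [e1, e2]
      exact ⟨h1, h2⟩
    · exact ⟨0, IsTestFun.zero, fun hi' => absurd hi' hi⟩
  choose s hs hsi using hex
  -- Each piece vanishes near the ends of its cell, so the glued function is again continuously
  -- differentiable, whatever jumps `f` has at the grid points.
  set F : ℝ → ℂ := ∑ i ∈ Finset.range M, fun x => s i (M * x - i) with hF
  have hFt : IsTestFun F := IsTestFun.sum fun i hi => (hs i).rescale (Finset.mem_range.1 hi)
  have hFx : ∀ i < M, ∀ x ∈ Ioo (0 : ℝ) 1, F ((x + i) / M) = s i x := fun i hi x hx => by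
    rw [hF, Finset.sum_apply]
    exact sum_cells_apply (fun i x => (hs i).eq_zero) hi hx
  have hdF : ∀ x, deriv F x = M * ∑ i ∈ Finset.range M, deriv (s i) (M * x - i) := fun x => by
    have hd : ∀ i ∈ Finset.range M, HasDerivAt (fun x : ℝ => s i (M * x - i))
        (M * deriv (s i) (M * x - i)) x := fun i _ => by
      have h1 : HasDerivAt (fun x : ℝ => (M : ℝ) * x - i) M x := by
        simpa using ((hasDerivAt_id x).const_mul (M : ℝ)).sub_const (i : ℝ)
      have h2 := ((hs i).contDiff.differentiable one_ne_zero (M * x - i)).hasDerivAt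
      have h3 := h2.scomp x h1
      simpa [Function.comp_def] using h3
    rw [Finset.mul_sum]
    exact (HasDerivAt.sum hd).deriv
  have hdFx : ∀ i < M, ∀ x ∈ Ioo (0 : ℝ) 1, deriv F ((x + i) / M) = M * deriv (s i) x :=
    fun i hi x hx => by
      rw [hdF, sum_cells_apply (s := fun i => deriv (s i)) (fun i x => (hs i).deriv_eq_zero) hi hx]
  have cF := restr_coeFn (g := F)
    ((indicator_Icc_eq_self fun x => hFt.eq_zero).symm ▸ hFt.memLp 2 volume)
  have cdF := restr_coeFn (g := deriv F)
    ((indicator_Icc_eq_self fun x => hFt.deriv_eq_zero).symm ▸ hFt.memLp_deriv 2 volume)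
  rw [indicator_Icc_eq_self fun x => hFt.eq_zero] at cF
  rw [indicator_Icc_eq_self fun x => hFt.deriv_eq_zero] at cdF
  refine ⟨F, hFt, ?_, ?_⟩
  · rw [norm_sq_H_eq_sum _ hM, norm_sq_H_eq_sum f hM, Finset.mul_sum]
    refine Finset.sum_le_sum fun i hi => ?_
    rw [mul_left_comm]
    gcongr
    refine le_trans (le_of_eq ?_) (hsi i (Finset.mem_range.1 hi)).1
    refine integral_congr_ae ?_
    have hq := quasiMeasurePreserving_cell hM'.ne' (i : ℝ)
    filter_upwards [ae_restrict_of_ae (hq.ae cF),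
      ae_restrict_of_ae (hq.ae (Lp.coeFn_sub (f : L2) (restr F : L2))),
      ae_restrict_mem measurableSet_Ioo] with x h1 h2 h3
    rw [Submodule.coe_sub, h2, Pi.sub_apply, h1, hFx i (Finset.mem_range.1 hi) x h3]
  · rw [norm_sq_H_eq_sum _ hM, norm_sq_H_eq_sum f hM, Finset.mul_sum]
    refine Finset.sum_le_sum fun i hi => ?_
    rw [mul_left_comm]
    gcongr
    -- The factor `M ^ 2` of the Bernstein inequality comes from the chain rule on each cell.
    have e : ∫ x in Ioo (0 : ℝ) 1, ‖(restr (deriv F) : L2) ((x + i) / M)‖ ^ 2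
        = M ^ 2 * ∫ x in Ioo (0 : ℝ) 1, ‖deriv (s i) x‖ ^ 2 := by
      rw [← integral_const_mul]
      refine integral_congr_ae ?_
      have hq := quasiMeasurePreserving_cell hM'.ne' (i : ℝ)
      filter_upwards [ae_restrict_of_ae (hq.ae cdF), ae_restrict_mem measurableSet_Ioo] with x h1 h2
      rw [h1, hdFx i (Finset.mem_range.1 hi) x h2, norm_mul, mul_pow, Complex.norm_natCast]
    rw [e, mul_comm C, mul_assoc]
    gcongr
    exact (hsi i (Finset.mem_range.1 hi)).2

/-- Split `f` into `f - restr s` and `restr s`: the upper frame bound handles the first, the decay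
`1/M²` for test functions the second. -/
theorem IsFourierFrame.exists_sum_sample_le {ω : ℤ → ℝ} {A B : ℝ} (h : IsFourierFrame ω A B)
    (N : Submodule ℂ (Lp ℂ 2 (volume.restrict (Ioo (0 : ℝ) 1)))) [FiniteDimensional ℂ N]
    {ε : ℝ} (hε : 0 < ε) :
    ∃ K : ℝ, 0 < K ∧ ∀ (M : ℕ) (f : H), 0 < M →
      (∀ i < M, ∃ u ∈ N, ∀ᵐ x ∂(volume.restrict (Ioo (0 : ℝ) 1)),
        (f : L2) ((x + i) / M) = u x) →
      ∀ t : Finset ℤ, (∀ n ∈ t, K * M ≤ |ω n|) →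
        ∑ n ∈ t, ‖sample (ω n) f‖ ^ 2 ≤ ε * ‖f‖ ^ 2 := by
  have hB := h.pos
  obtain ⟨C, hC, hN⟩ := exists_testFun_approx_of_cells N (δ := ε / (4 * B)) (by positivity)
  -- Both parts are made at most `ε/4 * ‖f‖²`; the inequality `(a + b)² ≤ 2a² + 2b²` doubles them,
  -- which still leaves room below `ε`. Using `C + 1` keeps `K` positive when `C = 0`.
  refine ⟨√(4 * B * (C + 1) / ε), by positivity, fun M f hM hf t ht => ?_⟩
  obtain ⟨s, hs, h1, h2⟩ := hN M f hM hf
  have hM' : (0 : ℝ) < M := by exact_mod_cast hM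
  have h3 := hs.sum_sample_le h (by positivity) t ht
  have h4 := h.sum_le (f - restr s) t
  have h5 : ∀ n ∈ t, ‖sample (ω n) f‖ ^ 2
      ≤ 2 * ‖sample (ω n) (f - restr s)‖ ^ 2 + 2 * ‖sample (ω n) (restr s)‖ ^ 2 := fun n _ => by
    have h6 : ‖sample (ω n) f‖ ≤ ‖sample (ω n) (f - restr s)‖ + ‖sample (ω n) (restr s)‖ := by
      have := norm_add_le (sample (ω n) (f - restr s)) (sample (ω n) (restr s))
      rwa [← map_add, sub_add_cancel] at this
    have h7 : ‖sample (ω n) f‖ ^ 2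
        ≤ (‖sample (ω n) (f - restr s)‖ + ‖sample (ω n) (restr s)‖) ^ 2 := by gcongr
    nlinarith [sq_nonneg (‖sample (ω n) (f - restr s)‖ - ‖sample (ω n) (restr s)‖)]
  have h8 := Finset.sum_le_sum h5
  rw [Finset.sum_add_distrib, ← Finset.mul_sum, ← Finset.mul_sum] at h8
  have h9 : B * ‖f - restr s‖ ^ 2 ≤ ε / 4 * ‖f‖ ^ 2 := by
    calc B * ‖f - restr s‖ ^ 2 ≤ B * (ε / (4 * B) * ‖f‖ ^ 2) := by gcongr
      _ = ε / 4 * ‖f‖ ^ 2 := by field_simp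
  have h10 : B * ‖restr (deriv s)‖ ^ 2 / (√(4 * B * (C + 1) / ε) * M) ^ 2 ≤ ε / 4 * ‖f‖ ^ 2 := by
    rw [mul_pow, Real.sq_sqrt (by positivity), div_le_iff₀ (by positivity)]
    calc B * ‖restr (deriv s)‖ ^ 2 ≤ B * (C * M ^ 2 * ‖f‖ ^ 2) := by gcongr
      _ ≤ B * ((C + 1) * M ^ 2 * ‖f‖ ^ 2) := by gcongr; linarith
      _ = _ := by field_simp
  nlinarith

/-! ### Locally finite-dimensional functions -/

/-- The integer translates of `φ` and of its reflection. -/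
def translates (φ : ℝ → ℂ) : Set (ℝ → ℂ) :=
  range (fun (k : ℤ) x => φ (x - k)) ∪ range (fun (k : ℤ) x => φ (-x - k))

/-- The rescaled piece of `g` on each dyadic interval of length `2⁻ᵐ` is, almost everywhere, a
combination of translates of `φ` and of its reflection. -/
def IsLocal (φ : ℝ → ℂ) (m : ℕ) (g : ℝ → ℂ) : Prop :=
  ∀ i : ℤ, ∃ y ∈ Submodule.span ℂ (translates φ),
    ∀ᵐ x ∂(volume.restrict (Ioo (0 : ℝ) 1)), g ((x + i) / 2 ^ m) = y x

theorem memLp_comp_affine {g : ℝ → ℂ} (hg : MemLp g 2 volume) {a : ℝ} (ha : a ≠ 0) (b : ℝ) :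
    MemLp (fun x => g (a * x + b)) 2 volume := by
  have h1 : MemLp (fun x => g (x + b)) 2 volume :=
    hg.comp_measurePreserving (measurePreserving_add_right volume b)
  have h2 : MemLp (fun x => g (x + b)) 2 (Measure.map (fun x => a * x) volume) := by
    rw [Real.map_volume_mul_left ha]
    exact h1.smul_measure ENNReal.ofReal_ne_top
  exact (memLp_map_measure_iff h2.1 (by fun_prop)).1 h2

theorem memLp_of_mem_translates {φ : ℝ → ℂ} (hφ : MemLp φ 2 volume) {y : ℝ → ℂ}
    (hy : y ∈ Submodule.span ℂ (translates φ)) : MemLp y 2 volume := by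
  induction hy using Submodule.span_induction with
  | mem y h =>
    rcases h with ⟨k, rfl⟩ | ⟨k, rfl⟩
    · simpa [sub_eq_add_neg] using memLp_comp_affine hφ one_ne_zero (-(k : ℝ))
    · simpa [sub_eq_add_neg] using memLp_comp_affine hφ (neg_ne_zero.2 one_ne_zero) (-(k : ℝ))
  | zero => exact MemLp.zero
  | add a b _ _ ha hb => exact ha.add hb
  | smul c a _ ha => exact ha.const_smul c

/-- The restrictions to `(0,1)` of the combinations of translates of `φ` and of its reflection. -/
def cellSpace (φ : ℝ → ℂ) : Submodule ℂ (Lp ℂ 2 (volume.restrict (Ioo (0 : ℝ) 1))) where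
  carrier := {u | ∃ y ∈ Submodule.span ℂ (translates φ), u =ᵐ[volume.restrict (Ioo (0 : ℝ) 1)] y}
  zero_mem' := ⟨0, Submodule.zero_mem _, Lp.coeFn_zero _ _ _⟩
  add_mem' := by
    rintro a b ⟨y, hy, ha⟩ ⟨z, hz, hb⟩
    exact ⟨y + z, add_mem hy hz, (Lp.coeFn_add a b).trans (ha.add hb)⟩
  smul_mem' := by
    rintro c a ⟨y, hy, ha⟩
    exact ⟨c • y, Submodule.smul_mem _ c hy, (Lp.coeFn_smul c a).trans (ha.const_smul c)⟩

theorem exists_mem_cellSpace {φ : ℝ → ℂ} (hφ : MemLp φ 2 volume) {y : ℝ → ℂ}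
    (hy : y ∈ Submodule.span ℂ (translates φ)) :
    ∃ u ∈ cellSpace φ, u =ᵐ[volume.restrict (Ioo (0 : ℝ) 1)] y :=
  have h := (memLp_of_mem_translates hφ hy).restrict (Ioo (0 : ℝ) 1)
  ⟨h.toLp y, ⟨y, hy, h.coeFn_toLp⟩, h.coeFn_toLp⟩

/-- By compact support, only finitely many translates of `φ` and of its reflection are nonzero on
`(0,1)`; the set `K` contains all of these. -/
theorem finiteDimensional_cellSpace {φ : ℝ → ℂ} (hφ : MemLp φ 2 volume) {P : ℕ}
    (hP : ∀ x, (P : ℝ) < |x| → φ x = 0) : FiniteDimensional ℂ (cellSpace φ) := by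
  classical
  let K : Set (ℝ → ℂ) := (fun (k : ℤ) x => φ (x - k)) '' Icc (-(P : ℤ) - 1) (P + 1) ∪
    (fun (k : ℤ) x => φ (-x - k)) '' Icc (-(P : ℤ) - 1) (P + 1)
  have hK : K.Finite := ((finite_Icc _ _).image _).union ((finite_Icc _ _).image _)
  have hKt : ∀ g ∈ K, g ∈ Submodule.span ℂ (translates φ) := by
    rintro g (⟨k, -, rfl⟩ | ⟨k, -, rfl⟩)
    · exact Submodule.subset_span (Or.inl ⟨k, rfl⟩)
    · exact Submodule.subset_span (Or.inr ⟨k, rfl⟩)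
  choose! T hT1 hT2 using fun g (hg : g ∈ K) => exists_mem_cellSpace hφ (hKt g hg)
  have hfin : FiniteDimensional ℂ (Submodule.span ℂ (T '' K)) :=
    FiniteDimensional.span_of_finite ℂ (hK.image T)
  have hzero : ∀ k : ℤ, k ∉ Icc (-(P : ℤ) - 1) (P + 1) → ∀ x : ℝ, |x| < 1 → φ (x - k) = 0 := by
    intro k hk x hx
    apply hP
    rw [abs_lt] at hx
    rw [mem_Icc, not_and_or] at hk
    rcases hk with hk | hk
    · have : (k : ℝ) ≤ -P - 1 - 1 := by exact_mod_cast (by omega : k ≤ -(P : ℤ) - 1 - 1)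
      exact lt_of_lt_of_le (by linarith [hx.1]) (le_abs_self _)
    · have : (P : ℝ) + 1 + 1 ≤ k := by exact_mod_cast (by omega : (P : ℤ) + 1 + 1 ≤ k)
      exact lt_of_lt_of_le (by linarith [hx.2]) (neg_le_abs _)
  have key : ∀ y ∈ Submodule.span ℂ (translates φ), ∃ u ∈ Submodule.span ℂ (T '' K),
      u =ᵐ[volume.restrict (Ioo (0 : ℝ) 1)] y := by
    intro y hy
    induction hy using Submodule.span_induction with
    | mem y h =>
      by_cases hyK : y ∈ K
      · exact ⟨T y, Submodule.subset_span ⟨y, hyK, rfl⟩, hT2 y hyK⟩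
      · refine ⟨0, Submodule.zero_mem _, ?_⟩
        filter_upwards [Lp.coeFn_zero ℂ 2 (volume.restrict (Ioo (0 : ℝ) 1)),
          ae_restrict_mem measurableSet_Ioo] with x hx hx1
        rw [hx, Pi.zero_apply]
        rcases h with ⟨k, rfl⟩ | ⟨k, rfl⟩
        · refine (hzero k (fun hk => hyK (Or.inl ⟨k, hk, rfl⟩)) x ?_).symm
          rw [abs_lt]; exact ⟨by linarith [hx1.1], hx1.2⟩
        · refine (hzero k (fun hk => hyK (Or.inr ⟨k, hk, rfl⟩)) (-x) ?_).symm
          rw [abs_neg, abs_lt]; exact ⟨by linarith [hx1.1], hx1.2⟩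
    | zero => exact ⟨0, Submodule.zero_mem _, Lp.coeFn_zero _ _ _⟩
    | add a b _ _ ha hb =>
      obtain ⟨u, hu, hua⟩ := ha
      obtain ⟨v, hv, hvb⟩ := hb
      exact ⟨u + v, add_mem hu hv, (Lp.coeFn_add u v).trans (hua.add hvb)⟩
    | smul c a _ ha =>
      obtain ⟨u, hu, hua⟩ := ha
      exact ⟨c • u, Submodule.smul_mem _ c hu, (Lp.coeFn_smul c u).trans (hua.const_smul c)⟩
  refine Submodule.finiteDimensional_of_le (S₂ := Submodule.span ℂ (T '' K)) ?_
  rintro u ⟨y, hy, huy⟩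
  obtain ⟨v, hv, hvy⟩ := key y hy
  rwa [Lp.ext (huy.trans hvy.symm)]

/-! ### Operations that preserve locality -/

namespace IsLocal

variable {φ : ℝ → ℂ} {m : ℕ}

theorem zero : IsLocal φ m 0 :=
  fun _ => ⟨0, Submodule.zero_mem _, Filter.Eventually.of_forall fun _ => rfl⟩

theorem add {f g : ℝ → ℂ} (hf : IsLocal φ m f) (hg : IsLocal φ m g) : IsLocal φ m (f + g) := by
  intro i
  obtain ⟨y, hy, h1⟩ := hf i
  obtain ⟨z, hz, h2⟩ := hg i
  refine ⟨y + z, add_mem hy hz, ?_⟩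
  filter_upwards [h1, h2] with x h1 h2
  rw [Pi.add_apply, Pi.add_apply, h1, h2]

theorem smul {f : ℝ → ℂ} (hf : IsLocal φ m f) (c : ℂ) : IsLocal φ m (c • f) := by
  intro i
  obtain ⟨y, hy, h1⟩ := hf i
  refine ⟨c • y, Submodule.smul_mem _ c hy, ?_⟩
  filter_upwards [h1] with x h1
  rw [Pi.smul_apply, Pi.smul_apply, h1]

theorem sum {ι : Type*} {t : Finset ι} {f : ι → ℝ → ℂ} (hf : ∀ i ∈ t, IsLocal φ m (f i)) :
    IsLocal φ m (fun x => ∑ i ∈ t, f i x) := by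
  have := Finset.sum_induction f (IsLocal φ m) (fun _ _ => IsLocal.add) IsLocal.zero hf
  convert this using 1
  ext x
  rw [Finset.sum_apply]

theorem congr_ae {f g : ℝ → ℂ} (hf : IsLocal φ m f) (h : f =ᵐ[volume] g) : IsLocal φ m g := by
  intro i
  obtain ⟨y, hy, h1⟩ := hf i
  refine ⟨y, hy, ?_⟩
  filter_upwards [h1, ae_restrict_of_ae
    ((quasiMeasurePreserving_cell (M := (2 : ℝ) ^ m) (by positivity) (i : ℝ)).ae h)] with x h1 h2
  rw [← h2, h1]

theorem comp_add {f : ℝ → ℂ} (hf : IsLocal φ m f) (n : ℤ) : IsLocal φ m (fun x => f (x + n)) := by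
  intro i
  obtain ⟨y, hy, h1⟩ := hf (i + n * 2 ^ m)
  refine ⟨y, hy, ?_⟩
  filter_upwards [h1] with x h1
  rw [← h1]
  congr 1
  push_cast
  field_simp
  ring

/-- Reflection sends cell `i` to cell `-i - 1` and reverses it by `x ↦ 1 - x`. The set `translates
φ` is stable under this because it contains the reflected translates too. -/
theorem comp_neg {f : ℝ → ℂ} (hf : IsLocal φ m f) : IsLocal φ m (fun x => f (-x)) := by
  intro i
  obtain ⟨y, hy, h1⟩ := hf (-i - 1)
  refine ⟨fun x => y (1 - x), ?_, ?_⟩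
  · clear h1
    induction hy using Submodule.span_induction with
    | mem y h =>
      refine Submodule.subset_span ?_
      rcases h with ⟨k, rfl⟩ | ⟨k, rfl⟩
      · refine Or.inr ⟨k - 1, ?_⟩
        ext x
        push_cast
        congr 1
        ring
      · refine Or.inl ⟨k + 1, ?_⟩
        ext x
        push_cast
        congr 1
        ring
    | zero => exact Submodule.zero_mem _
    | add a b _ _ ha hb => exact add_mem ha hb
    | smul c a _ ha => exact Submodule.smul_mem _ c ha
  · rw [ae_restrict_iff' measurableSet_Ioo] at h1 ⊢
    have h2 := (Measure.measurePreserving_sub_left (volume : Measure ℝ)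
      (1 : ℝ)).quasiMeasurePreserving.ae h1
    filter_upwards [h2] with x h2 hx
    rw [← h2 ⟨by linarith [hx.2], by linarith [hx.1]⟩]
    congr 1
    push_cast
    ring

/-- The cut at `0` is a grid point, so each open cell is either kept whole or discarded. -/
theorem indicator_Ici {f : ℝ → ℂ} (hf : IsLocal φ m f) :
    IsLocal φ m ((Ici (0 : ℝ)).indicator f) := by
  intro i
  by_cases hi : 0 ≤ i
  · obtain ⟨y, hy, h1⟩ := hf i
    refine ⟨y, hy, ?_⟩
    filter_upwards [h1, ae_restrict_mem measurableSet_Ioo] with x h1 hx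
    rw [indicator_of_mem, h1]
    have : (0 : ℝ) ≤ i := by exact_mod_cast hi
    have h0 : 0 ≤ x + i := by linarith [hx.1]
    exact mem_Ici.2 (div_nonneg h0 (by positivity))
  · refine ⟨0, Submodule.zero_mem _, ?_⟩
    filter_upwards [ae_restrict_mem measurableSet_Ioo] with x hx
    rw [indicator_of_notMem]
    · rfl
    · have : (i : ℝ) + 1 ≤ 0 := by exact_mod_cast (by omega : i + 1 ≤ 0)
      have := hx.2
      rw [mem_Ici, not_le]
      exact div_neg_of_neg_of_pos (by linarith) (by positivity)

theorem indicator_Icc {f : ℝ → ℂ} (hf : IsLocal φ m f) :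
    IsLocal φ m ((Icc (0 : ℝ) 1).indicator f) := by
  -- Two cuts at `0`, with the reflection `x ↦ 1 - x` applied after each: the second cut then
  -- removes `x > 1`.
  have h1 := (hf.indicator_Ici.comp_neg.comp_add (-1)).indicator_Ici.comp_neg.comp_add (-1)
  convert h1 using 1
  ext x
  by_cases hx : x ∈ Icc (0 : ℝ) 1
  · have h2 : (-(x + ((-1 : ℤ) : ℝ))) ∈ Ici (0 : ℝ) := by
      push_cast; rw [mem_Ici]; linarith [hx.2]
    rw [indicator_of_mem hx, indicator_of_mem h2]
    have h3 : (-(-(x + ((-1 : ℤ) : ℝ)) + ((-1 : ℤ) : ℝ))) = x := by push_cast; ring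
    simp only [h3]
    rw [indicator_of_mem (show x ∈ Ici (0 : ℝ) from hx.1)]
  · rw [indicator_of_notMem hx]
    rw [mem_Icc, not_and_or] at hx
    have h3 : (-(-(x + ((-1 : ℤ) : ℝ)) + ((-1 : ℤ) : ℝ))) = x := by push_cast; ring
    symm
    rw [indicator_apply_eq_zero]
    intro h2
    simp only [h3]
    rw [indicator_of_notMem]
    push_cast at h2
    rw [mem_Ici] at h2 ⊢
    rcases hx with hx | hx
    · exact hx
    · exact absurd (by linarith) hx

/-- Scaling by `2^j` carries the cells of level `m + j` onto those of level `m`, and the shift by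
`k` moves them by `k * 2^m` places. -/
theorem dil {f : ℝ → ℂ} (hf : IsLocal φ m f) (j : ℕ) (k : ℤ) :
    IsLocal φ (m + j) (NUGS.dil f j k) := by
  refine IsLocal.smul (f := fun x => f ((2 : ℝ) ^ (j : ℤ) * x - k)) (fun i => ?_) _
  obtain ⟨y, hy, h1⟩ := hf (i - k * 2 ^ m)
  refine ⟨y, hy, ?_⟩
  filter_upwards [h1] with x h1
  rw [← h1]
  congr 1
  push_cast
  rw [zpow_natCast, pow_add]
  field_simp
  ring

theorem toL2 {f : ℝ → ℂ} (hf : IsLocal φ m f) : IsLocal φ m (NUGS.toL2 f) := by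
  by_cases h : MemLp f 2 volume
  · exact hf.congr_ae (toL2_coeFn h).symm
  · rw [NUGS.toL2, dif_neg h]
    exact IsLocal.zero.congr_ae (Lp.coeFn_zero _ _ _).symm

theorem restr {f : ℝ → ℂ} (hf : IsLocal φ m f) : IsLocal φ m (NUGS.restr f : L2) :=
  hf.indicator_Icc.toL2

end IsLocal

/-- The square integrable functions that are local at level `m`. -/
def localSubmodule (φ : ℝ → ℂ) (m : ℕ) : Submodule ℂ L2 where
  carrier := {f | IsLocal φ m f}
  zero_mem' := IsLocal.zero.congr_ae (Lp.coeFn_zero _ _ _).symm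
  add_mem' := fun {a b} ha hb => (IsLocal.add ha hb).congr_ae (Lp.coeFn_add a b).symm
  smul_mem' := fun c {a} ha => (IsLocal.smul ha c).congr_ae (Lp.coeFn_smul c a).symm

/-! ### The spaces of a multiresolution analysis are local -/

/-- Restriction of a translate to one cell is a continuous map `Φ`, and it sends the generators of
`V 0` into `cellSpace φ`. That space is finite-dimensional, hence closed, so its preimage contains
the closed span as well. -/
theorem isLocal_of_mem_zero {φ : ℝ → ℂ} {V : ℤ → Submodule ℂ L2} (hφ : IsMRA φ V) {P : ℕ}
    (hP : ∀ x, (P : ℝ) < |x| → φ x = 0) {f : L2} (hf : f ∈ V 0) : IsLocal φ 0 f := by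
  intro i
  have hmp : MeasurePreserving (fun x : ℝ => x + i) volume volume :=
    measurePreserving_add_right volume (i : ℝ)
  let Φ : L2 →L[ℂ] Lp ℂ 2 (volume.restrict (Ioo (0 : ℝ) 1)) :=
    (LpToLpRestrictCLM ℝ ℂ ℂ volume 2 (Ioo (0 : ℝ) 1)).comp
      (Lp.compMeasurePreservingₗᵢ ℂ (fun x : ℝ => x + i) hmp).toContinuousLinearMap
  have hΦ : ∀ g : L2, Φ g =ᵐ[volume.restrict (Ioo (0 : ℝ) 1)] fun x => g (x + i) := fun g =>
    (LpToLpRestrictCLM_coeFn ℂ (Ioo (0 : ℝ) 1) _).trans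
      (ae_restrict_of_ae (Lp.coeFn_compMeasurePreserving g hmp))
  have := finiteDimensional_cellSpace hφ.memLp hP
  have hcl : IsClosed ((cellSpace φ).comap Φ.toLinearMap : Set L2) :=
    (Submodule.closed_of_finiteDimensional (cellSpace φ)).preimage Φ.continuous
  have hle : (Submodule.span ℂ (range fun k : ℤ => toL2 (dil φ 0 k))).topologicalClosure
      ≤ (cellSpace φ).comap Φ.toLinearMap := by
    refine Submodule.topologicalClosure_minimal _ (Submodule.span_le.2 ?_) hcl
    rintro _ ⟨k, rfl⟩
    refine ⟨fun x => φ (x - (k - i : ℤ)), Submodule.subset_span (Or.inl ⟨k - i, rfl⟩), ?_⟩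
    have hm : MemLp (dil φ 0 k) 2 volume := by
      have := memLp_comp_affine hφ.memLp one_ne_zero (-(k : ℝ))
      convert this using 2
      simp [dil, sub_eq_add_neg]
    refine (hΦ _).trans ?_
    filter_upwards [ae_restrict_of_ae (hmp.quasiMeasurePreserving.ae (toL2_coeFn hm))] with x hx
    rw [hx]
    simp only [dil, Int.cast_zero, zero_div, Real.rpow_zero, Complex.ofReal_one, one_mul, zpow_zero]
    congr 1
    push_cast
    ring
  rw [hφ.riesz.1] at hle
  obtain ⟨y, hy, h⟩ := hle hf
  refine ⟨y, hy, ?_⟩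
  filter_upwards [h, hΦ f] with x h1 h2
  rw [pow_zero, div_one, ← h1]
  exact h2.symm

theorem IsMRA.exists_dilate_mem {φ : ℝ → ℂ} {V : ℤ → Submodule ℂ L2} (hφ : IsMRA φ V) (m : ℕ) :
    ∀ f ∈ V m, ∃ g ∈ V 0, (g : ℝ → ℂ) =ᵐ[volume] fun x => (f : ℝ → ℂ) (x / 2 ^ m) := by
  induction m with
  | zero => exact fun f hf => ⟨f, hf, by simp⟩
  | succ m ih =>
    intro f hf
    have hm : MemLp (fun x => (f : ℝ → ℂ) (x / 2)) 2 volume := by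
      have := memLp_comp_affine (Lp.memLp f) (inv_ne_zero (two_ne_zero (α := ℝ))) 0
      convert this using 2
      ring_nf
    have h2 : (f : ℝ → ℂ) =ᵐ[volume] fun x => (hm.toLp _ : ℝ → ℂ) (2 * x) := by
      have hq := Measure.quasiMeasurePreserving_smul (volume : Measure ℝ) (two_ne_zero (α := ℝ))
      filter_upwards [hq.ae hm.coeFn_toLp] with x hx
      rw [smul_eq_mul] at hx
      rw [hx, mul_div_cancel_left₀ _ two_ne_zero]
    obtain ⟨g, hg, hgf⟩ := ih _ ((hφ.dilation m _ f h2).2 hf)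
    refine ⟨g, hg, hgf.trans ?_⟩
    have hq := quasiMeasurePreserving_cell (M := (2 : ℝ) ^ m) (by positivity) 0
    filter_upwards [hq.ae hm.coeFn_toLp] with x hx
    rw [add_zero] at hx
    rw [hx, div_div, pow_succ]

theorem IsMRA.isLocal {φ : ℝ → ℂ} {V : ℤ → Submodule ℂ L2} (hφ : IsMRA φ V) {P : ℕ}
    (hP : ∀ x, (P : ℝ) < |x| → φ x = 0) {m : ℕ} {f : L2} (hf : f ∈ V m) : IsLocal φ m f := by
  obtain ⟨g, hg, hgf⟩ := hφ.exists_dilate_mem m f hf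
  intro i
  obtain ⟨y, hy, h⟩ := isLocal_of_mem_zero hφ hP hg i
  refine ⟨y, hy, ?_⟩
  filter_upwards [h, ae_restrict_of_ae
    ((measurePreserving_add_right volume (i : ℝ)).quasiMeasurePreserving.ae hgf)] with x h1 h2
  rw [← h1, pow_zero, div_one, h2]

theorem IsMRA.monotone {φ : ℝ → ℂ} {V : ℤ → Submodule ℂ L2} (hφ : IsMRA φ V) : Monotone V :=
  monotone_int_of_le_succ hφ.nested

theorem toL2_dil_zero {f : ℝ → ℂ} (hf : MemLp f 2 volume) :
    (toL2 (dil f 0 0) : ℝ → ℂ) =ᵐ[volume] f := by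
  have h : dil f 0 0 = f := by
    ext x
    simp [dil]
  rw [h]
  exact toL2_coeFn hf

/-- This plays the role of the refinement equation: `φ` lies in `V 0 ⊆ V m`, so it is also local on
finer grids. -/
theorem IsMRA.isLocal_scaling {φ : ℝ → ℂ} {V : ℤ → Submodule ℂ L2} (hφ : IsMRA φ V) {P : ℕ}
    (hP : ∀ x, (P : ℝ) < |x| → φ x = 0) (m : ℕ) : IsLocal φ m φ := by
  have h0 : toL2 (dil φ 0 0) ∈ V 0 := by
    rw [← hφ.riesz.1]
    exact Submodule.le_topologicalClosure _ (Submodule.subset_span ⟨0, rfl⟩)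
  exact (hφ.isLocal hP (hφ.monotone (Int.natCast_nonneg m) h0)).congr_ae (toL2_dil_zero hφ.memLp)

theorem IsWavelet.isLocal {φ ψ : ℝ → ℂ} {V : ℤ → Submodule ℂ L2} (hψ : IsWavelet ψ V)
    (hφ : IsMRA φ V) {P : ℕ} (hP : ∀ x, (P : ℝ) < |x| → φ x = 0) {m : ℕ} (hm : 1 ≤ m) :
    IsLocal φ m ψ := by
  have h1 : toL2 (dil ψ 0 0) ∈ V 1 := by
    rw [← hψ.sup_eq]
    exact Submodule.mem_sup_right
      (Submodule.le_topologicalClosure _ (Submodule.subset_span ⟨0, rfl⟩))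
  exact (hφ.isLocal hP (hφ.monotone (by exact_mod_cast hm) h1)).congr_ae (toL2_dil_zero hψ.memLp)

/-! ### The reconstruction spaces are local -/

theorem dil_eq_zero {f : ℝ → ℂ} {P : ℕ} (hP : ∀ x, (P : ℝ) < |x| → f x = 0) (j k : ℕ) {x : ℝ}
    (hx : ((P + k : ℕ) : ℝ) < |x|) : dil f j k x = 0 := by
  rw [dil, hP, mul_zero]
  push_cast at hx ⊢
  have h1 : (1 : ℝ) ≤ 2 ^ (j : ℤ) := by
    rw [zpow_natCast]
    exact one_le_pow₀ one_le_two
  have h2 : |x| ≤ |(2 : ℝ) ^ (j : ℤ) * x| := by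
    rw [abs_mul, abs_of_pos (by positivity : (0 : ℝ) < 2 ^ (j : ℤ))]
    exact le_mul_of_one_le_left (abs_nonneg x) h1
  have h3 := abs_sub_abs_le_abs_sub ((2 : ℝ) ^ (j : ℤ) * x) k
  rw [abs_of_nonneg (by positivity : (0 : ℝ) ≤ k)] at h3
  linarith

theorem notMem_Icc_int {L : ℕ} {n : ℤ} (hn : n ∉ Finset.Icc (-(L : ℤ) - 1) (L + 1)) :
    (L : ℝ) + 2 ≤ |(n : ℝ)| := by
  rw [Finset.mem_Icc, not_and_or] at hn
  have : (L : ℤ) + 2 ≤ |n| := by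
    rcases hn with h | h
    · exact le_trans (by omega) (neg_le_abs n)
    · exact le_trans (by omega) (le_abs_self n)
  exact_mod_cast this

theorem IsLocal.periodize {φ f : ℝ → ℂ} {m L : ℕ} (hf : IsLocal φ m f)
    (hL : ∀ x, (L : ℝ) < |x| → f x = 0) :
    IsLocal φ m (NUGS.restr (NUGS.periodize f) : L2) := by
  -- On `[0,1]` all terms of the series outside this finite window vanish, by the support bound `L`.
  have h := (IsLocal.sum (t := Finset.Icc (-(L : ℤ) - 1) (L + 1))
    (f := fun n x => f (x + n)) fun n _ => hf.comp_add n).restr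
  convert h using 4
  unfold NUGS.restr
  congr 2
  ext x
  by_cases hx : x ∈ Icc (0 : ℝ) 1
  · rw [indicator_of_mem hx, indicator_of_mem hx]
    refine tsum_eq_sum fun n hn => hL _ ?_
    have h1 := notMem_Icc_int hn
    have h2 := abs_sub_abs_le_abs_sub (n : ℝ) (-x)
    rw [abs_neg, abs_of_nonneg hx.1, sub_neg_eq_add, add_comm (n : ℝ)] at h2
    linarith [hx.2]
  · rw [indicator_of_notMem hx, indicator_of_notMem hx]

theorem IsLocal.fold {φ f : ℝ → ℂ} {m L : ℕ} (hf : IsLocal φ m f)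
    (hL : ∀ x, (L : ℝ) < |x| → f x = 0) :
    IsLocal φ m (NUGS.restr (NUGS.fold f) : L2) := by
  have h1 := IsLocal.sum (t := Finset.Icc (-(L : ℤ) - 1) (L + 1))
    (f := fun n x => f (x + (-2 * n : ℤ))) fun n _ => hf.comp_add (-2 * n)
  have h2 := IsLocal.sum (t := Finset.Icc (-(L : ℤ) - 1) (L + 1))
    (f := fun n x => f (-x + (2 * n : ℤ))) fun n _ => (hf.comp_add (2 * n)).comp_neg
  have h := (h1.add h2).restr
  convert h using 4
  unfold NUGS.restr
  congr 2
  ext x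
  by_cases hx : x ∈ Icc (0 : ℝ) 1
  · rw [indicator_of_mem hx, indicator_of_mem hx, NUGS.fold, Pi.add_apply]
    have key : ∀ n : ℤ, n ∉ Finset.Icc (-(L : ℤ) - 1) (L + 1) → (L : ℝ) < |2 * (n : ℝ) - x| := by
      intro n hn
      have h1 := notMem_Icc_int hn
      have h2 := abs_sub_abs_le_abs_sub (2 * (n : ℝ)) x
      rw [abs_of_nonneg hx.1, abs_mul, abs_two] at h2
      have := abs_nonneg (n : ℝ)
      linarith [hx.2]
    rw [tsum_eq_sum (s := Finset.Icc (-(L : ℤ) - 1) (L + 1)) fun n hn => hL _ ?_,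
      tsum_eq_sum (s := Finset.Icc (-(L : ℤ) - 1) (L + 1)) fun n hn => hL _ (key n hn)]
    · congr 1
      · refine Finset.sum_congr rfl fun n _ => ?_
        congr 1
        push_cast
        ring
      · refine Finset.sum_congr rfl fun n _ => ?_
        congr 1
        push_cast
        ring
    · rw [abs_sub_comm]
      exact key n hn
  · rw [indicator_of_notMem hx, indicator_of_notMem hx]

/-- Gram–Schmidt vectors stay in the span of the input, which consists of local functions: integer
translates of `χ`, combined and cut at `0`. -/
theorem IsLocal.leftEdge {φ χ : ℝ → ℂ} {m : ℕ} (hχ : IsLocal φ m χ) (p : ℕ) (k : Fin p) :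
    IsLocal φ m (NUGS.leftEdge χ p k) := by
  have hv : ∀ i : Fin p, NUGS.toL2 (preLeft χ p (Fin.rev i)) ∈ localSubmodule φ m := fun i => by
    change IsLocal φ m _
    refine IsLocal.toL2 (IsLocal.indicator_Ici (IsLocal.sum
      (f := fun (n : ℕ) x => (n.choose (Fin.rev i) : ℂ) * χ (x + n - p + 1))
      fun n _ => IsLocal.smul (f := fun x => χ (x + n - p + 1)) ?_ _))
    have h := hχ.comp_add ((n : ℤ) - p + 1)
    convert h using 2
    push_cast
    ring_nf
  have h1 : InnerProductSpace.gramSchmidtNormed ℂ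
      (fun i : Fin p => NUGS.toL2 (preLeft χ p (Fin.rev i))) (Fin.rev k) ∈
      Submodule.span ℂ (range fun i : Fin p => NUGS.toL2 (preLeft χ p (Fin.rev i))) := by
    rw [← InnerProductSpace.span_gramSchmidt, ← InnerProductSpace.span_gramSchmidtNormed_range]
    exact Submodule.subset_span ⟨_, rfl⟩
  exact Submodule.span_le.2 (range_subset_iff.2 hv) h1

theorem IsLocal.rightEdge {φ χ : ℝ → ℂ} {m : ℕ} (hχ : IsLocal φ m χ) (p : ℕ) (k : Fin p) :
    IsLocal φ m (NUGS.rightEdge χ p k) := by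
  refine IsLocal.comp_neg (IsLocal.leftEdge ?_ p k)
  have h := (hχ.comp_add 1).comp_neg
  convert h using 2
  push_cast
  ring_nf

theorem IsLocal.intScaling {φ χ : ℝ → ℂ} {m : ℕ} (hχ : IsLocal φ m χ) (p j k : ℕ) :
    IsLocal φ (m + j) (NUGS.intScaling χ p j k) := by
  by_cases h : k < p
  · have h1 := (hχ.leftEdge p ⟨k, h⟩).dil j 0
    convert h1 using 1
    ext x
    rw [NUGS.intScaling, dif_pos h, NUGS.dil]
    push_cast
    rw [zpow_natCast, sub_zero]
  · by_cases h' : 2 ^ j - k - 1 < p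
    -- Since `2^j * (x - 1) = 2^j * x - 2^j`, the right edge function is a dilated translate with
    -- shift `2^j`.
    · have h1 := (hχ.rightEdge p ⟨2 ^ j - k - 1, h'⟩).dil j (2 ^ j)
      convert h1 using 1
      ext x
      rw [NUGS.intScaling, dif_neg h, dif_pos h', NUGS.dil]
      push_cast
      rw [zpow_natCast, mul_sub, mul_one]
    · have h1 := hχ.dil j k
      convert h1 using 1
      ext x
      rw [NUGS.intScaling, dif_neg h, dif_neg h']

/-- The elements of `H` that are local at level `m`. -/
def localH (φ : ℝ → ℂ) (m : ℕ) : Submodule ℂ H := (localSubmodule φ m).comap H.subtype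

section

variable {φ ψ : ℝ → ℂ} {V : ℤ → Submodule ℂ L2} {P : ℕ}

/-- Level `m` is reached by viewing `φ` as local at level `d = m - j` before dilating by `2^j`. -/
theorem scalingSpace_le_localH (hφ : IsMRA φ V) (hP : ∀ x, (P : ℝ) < |x| → φ x = 0) (p : ℕ)
    (type : WaveletType) {j m : ℕ} (hj : j ≤ m) : scalingSpace φ p type j ≤ localH φ m := by
  obtain ⟨d, rfl⟩ := Nat.exists_eq_add_of_le' hj
  have hd := hφ.isLocal_scaling hP d
  cases type with
  | per =>
    refine Submodule.span_le.2 ?_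
    rintro _ ⟨k, -, rfl⟩
    exact (hd.dil j k).periodize fun x => dil_eq_zero hP j k
  | fold ι =>
    refine Submodule.span_le.2 ?_
    rintro _ ⟨k, -, rfl⟩
    exact (hd.dil j k).fold fun x => dil_eq_zero hP j k
  | int =>
    refine Submodule.span_le.2 ?_
    rintro _ ⟨k, -, rfl⟩
    exact (hd.intScaling p j k).restr

/-- The inequality `j < m` is strict because a wavelet lives one level finer: `ψ` is in `V 1`, and
in the boundary case `W_j` is in `V_{j+1}`. -/
theorem waveletSpace_le_localH (hφ : IsMRA φ V) (hψ : IsWavelet ψ V)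
    (hP : ∀ x, (P : ℝ) < |x| → φ x = 0) {Q : ℕ} (hQ : ∀ x, (Q : ℝ) < |x| → ψ x = 0) (p : ℕ)
    (type : WaveletType) {j m : ℕ} (hj : j < m) : waveletSpace φ ψ p type j ≤ localH φ m := by
  cases type with
  | per =>
    obtain ⟨d, rfl⟩ := Nat.exists_eq_add_of_le' hj.le
    refine Submodule.span_le.2 ?_
    rintro _ ⟨k, -, rfl⟩
    exact ((hψ.isLocal hφ hP (by omega)).dil j k).periodize fun x => dil_eq_zero hQ j k
  | fold ι =>
    obtain ⟨d, rfl⟩ := Nat.exists_eq_add_of_le' hj.le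
    refine Submodule.span_le.2 ?_
    rintro _ ⟨k, -, rfl⟩
    exact ((hψ.isLocal hφ hP (by omega)).dil j k).fold fun x => dil_eq_zero hQ j k
  | int => exact inf_le_left.trans (scalingSpace_le_localH hφ hP p .int hj)

theorem reconstructionSpace_le_localH (hφ : IsMRA φ V) (hψ : IsWavelet ψ V)
    (hP : ∀ x, (P : ℝ) < |x| → φ x = 0) {Q : ℕ} (hQ : ∀ x, (Q : ℝ) < |x| → ψ x = 0) (p : ℕ)
    (type : WaveletType) {J R : ℕ} (hJR : J ≤ R) :
    reconstructionSpace φ ψ p type J R ≤ localH φ R :=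
  sup_le (scalingSpace_le_localH hφ hP p type hJR) (iSup₂_le fun _ hj =>
    waveletSpace_le_localH hφ hψ hP hQ p type (Finset.mem_Ico.1 hj).2)

end

/-! ### Finite dimension of the reconstruction spaces -/

theorem finiteDimensional_scalingSpace (φ : ℝ → ℂ) (p : ℕ) (type : WaveletType) (j : ℕ) :
    FiniteDimensional ℂ (scalingSpace φ p type j) := by
  have hfin : ∀ (M : ℕ) (P : ℕ → Prop) (F : ℕ → H), (∀ k, P k → k ≤ M) →
      FiniteDimensional ℂ (Submodule.span ℂ {f | ∃ k, P k ∧ f = F k}) := fun M P F hM => by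
    refine FiniteDimensional.span_of_finite ℂ (((finite_Iic M).image F).subset ?_)
    rintro _ ⟨k, hk, rfl⟩
    exact ⟨k, hM k hk, rfl⟩
  cases type with
  | per => exact hfin (2 ^ j) _ _ fun k hk => hk.le
  | fold ι => exact hfin (2 ^ j) _ _ fun k hk => (Nat.le_add_right _ _).trans hk
  | int => exact hfin (2 ^ j) _ _ fun k hk => hk.le

theorem finiteDimensional_waveletSpace (φ ψ : ℝ → ℂ) (p : ℕ) (type : WaveletType) (j : ℕ) :
    FiniteDimensional ℂ (waveletSpace φ ψ p type j) := by
  cases type with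
  | per => exact finiteDimensional_scalingSpace ψ p .per j
  | fold ι =>
    -- The value `ι = 0` gives the largest index range, `k ≤ 2^j`, which contains the range `k <
    -- 2^j` of the wavelets.
    have := finiteDimensional_scalingSpace ψ p (.fold 0) j
    refine Submodule.finiteDimensional_of_le (S₂ := scalingSpace ψ p (.fold 0) j)
      (Submodule.span_mono ?_)
    rintro _ ⟨k, hk, rfl⟩
    exact ⟨k, by simpa using hk.le, rfl⟩
  | int =>
    have := finiteDimensional_scalingSpace φ p .int (j + 1)
    exact Submodule.finiteDimensional_of_le (S₂ := scalingSpace φ p .int (j + 1)) inf_le_left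

theorem finiteDimensional_reconstructionSpace (φ ψ : ℝ → ℂ) (p : ℕ) (type : WaveletType)
    (J R : ℕ) : FiniteDimensional ℂ (reconstructionSpace φ ψ p type J R) := by
  have := finiteDimensional_scalingSpace φ p type J
  have := finiteDimensional_waveletSpace φ ψ p type
  unfold reconstructionSpace
  have : FiniteDimensional ℂ (⨆ j ∈ Finset.Ico J R, waveletSpace φ ψ p type j : Submodule ℂ H) := by
    rw [← Finset.sup_eq_iSup]
    exact Submodule.finiteDimensional_finset_sup _ _
  infer_instance

/-! ### The partial frame operator -/

theorem inner_partialFrameOp (ω : ℤ → ℝ) (N : ℕ) (f g : H) :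
    ⟪partialFrameOp ω N f, g⟫_ℂ =
      ∑ n ∈ Finset.Icc (-(N : ℤ)) N, starRingEnd ℂ (sample (ω n) f) * sample (ω n) g := by
  simp only [partialFrameOp, _root_.sum_apply, ContinuousLinearMap.smulRight_apply,
    sum_inner, inner_smul_left]
  refine Finset.sum_congr rfl fun n _ => ?_
  rw [inner_restr_expFun, sample_apply (ω n) g]

theorem re_inner_partialFrameOp_self (ω : ℤ → ℝ) (N : ℕ) (f : H) :
    (⟪partialFrameOp ω N f, f⟫_ℂ).re =
      ∑ n ∈ Finset.Icc (-(N : ℤ)) N, ‖sample (ω n) f‖ ^ 2 := by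
  rw [inner_partialFrameOp, Complex.re_sum]
  refine Finset.sum_congr rfl fun n _ => ?_
  rw [← Complex.normSq_eq_conj_mul_self, Complex.ofReal_re, Complex.normSq_eq_norm_sq]

theorem isAdmissible_partialFrameOp (ω : ℤ → ℝ) (N : ℕ) (T : Submodule ℂ H)
    (hT : FiniteDimensional ℂ T) {c : ℝ} (hc : 0 < c)
    (h : ∀ f ∈ T, c * ‖f‖ ^ 2 ≤ (⟪partialFrameOp ω N f, f⟫_ℂ).re) :
    IsAdmissible (scheme ω N) T (partialFrameOp ω N) where
  finite_scheme := (finite_Icc _ _).image ω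
  finiteDimensional := hT
  depends_on_samples := fun f g hfg => by
    simp only [partialFrameOp, _root_.sum_apply, ContinuousLinearMap.smulRight_apply]
    refine Finset.sum_congr rfl fun n hn => ?_
    rw [hfg (ω n) ⟨n, Finset.mem_Icc.1 hn, rfl⟩]
  selfAdjoint := fun f g => by
    rw [← inner_conj_symm f, inner_partialFrameOp, inner_partialFrameOp, map_sum]
    refine Finset.sum_congr rfl fun n _ => ?_
    rw [map_mul, Complex.conj_conj, mul_comm]
  cauchySchwarz := fun f g => by
    rw [inner_partialFrameOp, re_inner_partialFrameOp_self, re_inner_partialFrameOp_self]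
    refine (norm_sum_le _ _).trans (Real.le_sqrt_of_sq_le ?_)
    simp only [norm_mul, RCLike.norm_conj]
    exact Finset.sum_mul_sq_le_sq_mul_sq _ _ _
  bounded_below := ⟨c, hc, h⟩

theorem reconstructionConstant_le {S : H →L[ℂ] H} {T : Submodule ℂ H} {B c : ℝ} (hc : 0 < c)
    (h0 : ∀ f : H, 0 ≤ (⟪S f, f⟫_ℂ).re) (h1 : ∀ f ∈ T, c * ‖f‖ ^ 2 ≤ (⟪S f, f⟫_ℂ).re)
    (h2 : ∀ f : H, (⟪S f, f⟫_ℂ).re ≤ B * ‖f‖ ^ 2) :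
    reconstructionConstant S T ≤ Real.sqrt (B / c) := by
  have hnn : ∀ b ∈ {b : ℝ | ∀ f : H, (⟪S f, f⟫_ℂ).re ≤ b * ‖f‖ ^ 2}, 0 ≤ b := fun b hb => by
    have h := (h0 (restr (expFun 0))).trans (hb (restr (expFun 0)))
    rwa [norm_restr_expFun, one_pow, mul_one] at h
  have hC2 : constC2 S ≤ B := csInf_le ⟨0, hnn⟩ h2
  have hB : 0 ≤ B := hnn B h2
  refine Real.sqrt_le_sqrt ?_
  -- For the zero space every real number is an admissible lower constant; `sSup univ = 0` and
  -- division by zero make the quotient `0`, so the bound holds.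
  by_cases hT : T = ⊥
  · have hset : {c : ℝ | ∀ f ∈ T, c * ‖f‖ ^ 2 ≤ (⟪S f, f⟫_ℂ).re} = univ := by
      refine eq_univ_of_forall fun c f hf => ?_
      rw [hT, Submodule.mem_bot] at hf
      simp [hf]
    rw [constC1, hset, Real.sSup_univ, div_zero]
    positivity
  · obtain ⟨f, hf, hf0⟩ := Submodule.exists_mem_ne_zero_of_ne_bot hT
    have hfn : 0 < ‖f‖ ^ 2 := pow_pos (norm_pos_iff.2 hf0) 2
    have hC1 : c ≤ constC1 S T := by
      -- A nonzero `f` in `T` bounds the set of lower constants above by its Rayleigh quotient, so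
      -- the supremum is a true one.
      refine le_csSup ⟨(⟪S f, f⟫_ℂ).re / ‖f‖ ^ 2, fun b hb => ?_⟩ h1
      rw [le_div_iff₀ hfn]
      exact hb f hf
    exact div_le_div₀ hB hC2 hc hC1

/-- The tail bound is assumed on finite sets of omitted indices; every finite partial sum of the
frame series is then at most the head plus `ε‖f‖²`, and hence so is its limit. -/
theorem IsFourierFrame.le_inner_partialFrameOp {ω : ℤ → ℝ} {A B ε : ℝ}
    (h : IsFourierFrame ω A B) {N : ℕ} {f : H}
    (hf : ∀ t : Finset ℤ, (∀ n ∈ t, n ∉ Finset.Icc (-(N : ℤ)) N) →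
      ∑ n ∈ t, ‖sample (ω n) f‖ ^ 2 ≤ ε * ‖f‖ ^ 2) :
    (A - ε) * ‖f‖ ^ 2 ≤ (⟪partialFrameOp ω N f, f⟫_ℂ).re := by
  classical
  rw [re_inner_partialFrameOp_self]
  have h1 : ∑' n, ‖sample (ω n) f‖ ^ 2
      ≤ ∑ n ∈ Finset.Icc (-(N : ℤ)) N, ‖sample (ω n) f‖ ^ 2 + ε * ‖f‖ ^ 2 := by
    refine (h.2 f).1.tsum_le_of_sum_le fun t => ?_
    rw [← Finset.sum_inter_add_sum_sdiff t (Finset.Icc (-(N : ℤ)) N)]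
    refine add_le_add (Finset.sum_le_sum_of_subset_of_nonneg Finset.inter_subset_right
      fun _ _ _ => by positivity) (hf _ fun n hn => (Finset.mem_sdiff.1 hn).2)
  linarith [(h.2 f).2.1]

end NUGS

end

/-! ### The theorem -/

open NUGS in
theorem theorem5p5
    (ω : ℤ → ℝ) (hω : Monotone ω) (A B : ℝ) (hframe : IsFourierFrame ω A B)
    (φ ψ : ℝ → ℂ) (V : ℤ → Submodule ℂ L2) (hφ : IsMRA φ V) (hψ : IsWavelet ψ V)
    (p : ℕ) (hφsupp : Function.support φ ⊆ Set.Icc (-(p : ℝ) + 1) p)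
    (hψsupp : HasCompactSupport ψ)
    (hdecay : ∃ c α : ℝ, 1 / 2 < α ∧
      ∀ w : ℝ, ‖FourierTransform.fourier φ w‖ ≤ c / (1 + |w|) ^ α)
    (type : WaveletType) (ε : ℝ) (hε : 0 < ε) (hεA : ε < A) :
    ∃ c₀ : ℝ, 0 < c₀ ∧ ∀ J R N : ℕ, J ≤ R → (type = WaveletType.int → 2 * p ≤ 2 ^ J) →
      c₀ * 2 ^ R ≤ (N : ℝ) →
        IsAdmissible (scheme ω N) (reconstructionSpace φ ψ p type J R) (partialFrameOp ω N) ∧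
        reconstructionConstant (partialFrameOp ω N) (reconstructionSpace φ ψ p type J R) ≤
          Real.sqrt (B / (A - ε)) := by
  have hP : ∀ x, (p : ℝ) < |x| → φ x = 0 := fun x hx => by
    by_contra h
    obtain ⟨h1, h2⟩ := hφsupp h
    exact hx.not_ge (abs_le.2 ⟨by linarith, h2⟩)
  obtain ⟨r, hr⟩ := hψsupp.isCompact.isBounded.exists_norm_le
  obtain ⟨Q, hrQ⟩ := exists_nat_ge r
  have hQ : ∀ x, (Q : ℝ) < |x| → ψ x = 0 := fun x hx =>
    image_eq_zero_of_notMem_tsupport fun h => hx.not_ge ((hr x h).trans hrQ)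
  have := finiteDimensional_cellSpace hφ.memLp hP
  obtain ⟨K, hK, htail⟩ := hframe.exists_sum_sample_le (cellSpace φ) hε
  obtain ⟨a, b, ha, hgrowth⟩ := hframe.exists_growth hω
  -- Chosen so that `a * N - b ≥ (K + |b|) * 2^R - |b| ≥ K * 2^R`, using `2^R ≥ 1`.
  refine ⟨(K + |b|) / a, by positivity, fun J R N hJR _ hN => ?_⟩
  have hlow : ∀ n : ℤ, n ∉ Finset.Icc (-(N : ℤ)) N → K * (2 ^ R : ℕ) ≤ |ω n| := fun n hn => by
    have h1 := hgrowth N n hn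
    have h2 : (K + |b|) * 2 ^ R ≤ a * N := by
      calc (K + |b|) * 2 ^ R = a * ((K + |b|) / a * 2 ^ R) := by field_simp
        _ ≤ a * N := by gcongr
    have h3 : |b| * 1 ≤ |b| * 2 ^ R := by
      gcongr
      exact one_le_pow₀ one_le_two
    push_cast
    linarith [le_abs_self b]
  have hbelow : ∀ f ∈ reconstructionSpace φ ψ p type J R,
      (A - ε) * ‖f‖ ^ 2 ≤ (inner ℂ (partialFrameOp ω N f) f).re := fun f hf => by
    refine hframe.le_inner_partialFrameOp fun t ht => ?_
    -- The number of cells is `M = 2^R`: locality at level `R` puts each rescaled piece of `f` in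
    -- `cellSpace φ`.
    refine htail (2 ^ R) f (by positivity) (fun i _ => ?_) t fun n hn => hlow n (ht n hn)
    obtain ⟨y, hy, h1⟩ := reconstructionSpace_le_localH hφ hψ hP hQ p type hJR hf i
    obtain ⟨u, hu, h2⟩ := exists_mem_cellSpace hφ.memLp hy
    refine ⟨u, hu, ?_⟩
    filter_upwards [h1, h2] with x h1 h2
    rw [h2, ← h1]
    push_cast
    rfl
  refine ⟨isAdmissible_partialFrameOp ω N _
    (finiteDimensional_reconstructionSpace φ ψ p type J R) (sub_pos.2 hεA) hbelow,
    reconstructionConstant_le (sub_pos.2 hεA) (fun f => ?_) hbelow fun f => ?_⟩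
  · rw [re_inner_partialFrameOp_self]
    positivity
  · rw [re_inner_partialFrameOp_self]
    exact hframe.sum_le f _
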